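/- Let $X$ be the set of sequences $a=(a_1,a_2,\dots)$ of bounded measurable $2\pi$-periodic functions $a_i:\mathbb R\to\mathbb C$ such that, for some $l>0$ depending on $a$, $\sup_x|a_i(x)|\le l^i$ for all $i\ge 1$. For $a,b\in X$ define $a*b\in X$ and $a^{-1}\in X$ componentwise as the $2\pi$-periodic extensions of $$(a_i*b_i)(t)=\begin{cases}2a_i(2t),&0<t\le\pi,\\ 2b_i(2t-2\pi),&\pi<t\le 2\pi,\end{cases}\qquad a_i^{-1}(t)=-a_i(2\pi-t).$$ For integers $i_1,\dots,i_k\ge 1$, $k\ge 0$, the basic iterated integrals are $$I_{i_1,\dots,i_k}(a)=\int\cdots\int_{0\le s_1\le\cdots\le s_k\le 2\pi}a_{i_k}(s_k)\cdots a_{i_1}(s_1)\,ds_k\cdots ds_1$$ (equal to $1$ for $k=0$). Write $a\sim b$ if every basic iterated integral with $k\ge1$ vanishes at $a*b^{-1}$. This is an equivalence relation, and the set $G(X)$ of classes $[a]$ is a group under $[a]\cdot[b]=[a*b]$, with unit $[0]$ and inverse $[a]^{-1}=[a^{-1}]$; the basic iterated integrals are well defined on $G(X)$, and $G(X)$ carries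 the weakest topology making all of them continuous. Let $G_c[[r]]$ be the set of complex power series $f(r)=r+\sum_{k\ge1}d_k(f)r^{k+1}$ that converge in a neighbourhood of $0$, with the weakest topology making all $d_k$, $k\ge1$, continuous. For $a\in X$ consider the equation $\frac{dv}{dx}=\sum_{i\ge1}a_i(x)v^{i+1}$ on $[0,2\pi]$; a solution is a Lipschitz function $v$ on $[0,2\pi]$ for which, for almost every $x$, the series converges and the equation holds. The first return map of $a$ is the element $P(a)\in G_c[[r]]$ such that for all sufficiently small $r\in\mathbb C$ a solution with $v(0)=r$ exists and every such solution satisfies $v(2\pi)=P(a)(r)$. Let $\widehat P:G(X)\to G_c[[r]]$ be the map $\widehat P([a])=P(a)$, and let $\widehat{\mathcal C}=\{g\in G(X):\widehat P(g)(r)=r\}$ be its kernel, with the topology induced from $G(X)$. For $f=r+\sum_{k\ge1}d_kr^{k+1}\in G_c[[r]]$ let $a(f)=(a_1,a_2,\dots)\in X$ be given by the identity of formal power series in $t$ $$\sum_{i\ge1}a_i(x)t^{i+1}=\frac{\sum_{k\ge1}(d_k/2\pi)\,t^{k+1}}{1+\sum_{k\ge1}(k+1)d_k(1-x/2\pi)\,t^k},\qquad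 x\in(0,2\pi],$$ extended $2\pi$-periodically in $x$, and put $T(f)=[a(f)]$. **Theorem 3.10.** The first return map $P(a)$ exists for every $a\in X$, and $P(a)$ depends only on the class $[a]$, so that $\widehat P$ is well defined. The map $T:G_c[[r]]\to G(X)$ is a continuous embedding (a homeomorphism onto its image) with $\widehat P\circ T=\mathrm{id}$. Moreover, the map $\widetilde T:G_c[[r]]\times\widehat{\mathcal C}\to G(X)$, $\widetilde T(f,g)=T(f)\cdot g$, is a homeomorphism. -/

import Mathlib

open MeasureTheory Set

noncomputable section

namespace CenterProblem

/-! ### Bounded periodic coefficients -/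

/-- The representative of `t` modulo `2π` in `(0, 2π]`. -/
def angle (t : ℝ) : ℝ := toIocMod Real.two_pi_pos 0 t

lemma angle_mem (t : ℝ) : angle t ∈ Ioc 0 (2 * Real.pi) := by
  simpa [angle] using toIocMod_mem_Ioc Real.two_pi_pos 0 t

lemma angle_of_mem {t : ℝ} (ht : t ∈ Ioc 0 (2 * Real.pi)) : angle t = t := by
  rw [angle, toIocMod_eq_self]; simpa using ht

lemma angle_periodic : Function.Periodic angle (2 * Real.pi) :=
  toIocMod_periodic Real.two_pi_pos 0

lemma measurable_angle : Measurable angle := by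
  have h : angle = fun t : ℝ => t - ((⌈t / (2 * Real.pi)⌉ : ℤ) - 1 : ℝ) * (2 * Real.pi) := by
    funext t
    have hp := Real.two_pi_pos
    have h1 := Int.le_ceil (t / (2 * Real.pi))
    have h2 := Int.ceil_lt_add_one (t / (2 * Real.pi))
    have h3 : t = t / (2 * Real.pi) * (2 * Real.pi) := by field_simp
    rw [angle, toIocMod_eq_iff]
    refine ⟨⟨?_, ?_⟩, ⌈t / (2 * Real.pi)⌉ - 1, ?_⟩
    · nlinarith
    · nlinarith
    · simp [zsmul_eq_mul]
  rw [h]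
  have hc : Measurable fun t : ℝ => ((⌈t / (2 * Real.pi)⌉ : ℤ) : ℝ) :=
    (measurable_from_top (f := fun n : ℤ => (n : ℝ))).comp
      (Int.measurable_ceil.comp (measurable_id.div_const _))
  exact measurable_id.sub ((hc.sub_const _).mul_const _)

/-- `IsCoeff a` says that the sequence `a` (whose entry `a i` stands for `a_{i+1}`) consists of
bounded measurable `2π`-periodic functions with `sup |a_j| ≤ l ^ j`, `j = 1, 2, …`, for some
positive `l`. -/
def IsCoeff (a : ℕ → ℝ → ℂ) : Prop :=
  (∀ i, Measurable (a i)) ∧ (∀ i, Function.Periodic (a i) (2 * Real.pi)) ∧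
    ∃ l : ℝ, 0 < l ∧ ∀ i x, ‖a i x‖ ≤ l ^ (i + 1)

/-- The space `X` of coefficient sequences; `a.1 i` is the function `a_{i+1}`. -/
structure X : Type where
  coeff : ℕ → ℝ → ℂ
  isCoeff : IsCoeff coeff

/-- The `2π`-periodic function equal to `2 a(2t)` on `(0, π]` and to `2 b(2t - 2π)` on
`(π, 2π]`. -/
def concat (a b : ℝ → ℂ) (t : ℝ) : ℂ :=
  if angle t ≤ Real.pi then 2 * a (2 * angle t) else 2 * b (2 * angle t - 2 * Real.pi)

/-- The product `a * b` in `X`. -/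
instance : Mul X where
  mul a b := ⟨fun i => concat (a.1 i) (b.1 i), by
    obtain ⟨a, ham, -, la, hla, ha⟩ := a
    obtain ⟨b, hbm, -, lb, hlb, hb⟩ := b
    refine ⟨fun i => ?_, fun i t => ?_, 2 * max la lb, by positivity, fun i x => ?_⟩
    · refine Measurable.ite (measurableSet_le measurable_angle measurable_const) ?_ ?_
      · exact ((ham i).comp (measurable_angle.const_mul 2)).const_mul 2
      · exact ((hbm i).comp ((measurable_angle.const_mul 2).sub_const _)).const_mul 2
    · simp only [concat, angle_periodic t]
    · have h2 : (2 : ℝ) ≤ 2 ^ (i + 1) := by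
        rw [pow_succ]; linarith [one_le_pow₀ (M₀ := ℝ) (a := 2) (n := i) (by norm_num)]
      rw [mul_pow]
      simp only [concat]
      split_ifs
      · rw [norm_mul, Complex.norm_ofNat]
        exact mul_le_mul h2 ((ha i _).trans (pow_le_pow_left₀ hla.le (le_max_left _ _) _))
          (norm_nonneg _) (by positivity)
      · rw [norm_mul, Complex.norm_ofNat]
        exact mul_le_mul h2 ((hb i _).trans (pow_le_pow_left₀ hlb.le (le_max_right _ _) _))
          (norm_nonneg _) (by positivity)⟩

/-- The element `a⁻¹` of `X`, `a⁻¹(t) = -a(2π - t)`. -/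
instance : Inv X where
  inv a := ⟨fun i t => - a.1 i (2 * Real.pi - t), by
    obtain ⟨a, ham, hap, l, hl, ha⟩ := a
    refine ⟨fun i => ?_, fun i t => ?_, l, hl, fun i x => ?_⟩
    · exact ((ham i).comp (measurable_const.sub measurable_id)).neg
    · show - a i _ = - a i _
      rw [← hap i (2 * Real.pi - (t + 2 * Real.pi))]
      congr 2; ring
    · rw [norm_neg]; exact ha i _⟩

/-- The element `0` of `X`. -/
instance : Zero X where
  zero := ⟨fun _ _ => 0, fun _ => measurable_const, fun _ _ => rfl, 1, one_pos, by simp⟩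

/-! ### Iterated integrals and the group `G(X)` -/

/-- The iterated integral over `0 ≤ s_1 ≤ ⋯ ≤ s_k ≤ x`, computed from the outermost variable
`s_k` inwards: for the list `[j_k, …, j_1]` it is
`∫_0^x a_{i_k}(s_k) ∫_0^{s_k} ⋯ ∫_0^{s_2} a_{i_1}(s_1) ds_1 ⋯ ds_k` with `i_m = j_m + 1`. -/
def iterInt (a : ℕ → ℝ → ℂ) : List ℕ → ℝ → ℂ
  | [], _ => 1
  | j :: w, x => ∫ s in (0 : ℝ)..x, a j s * iterInt a w s

/-- The basic iterated integral `I_{i_1, …, i_k}` on `X`, for the list `[i_k - 1, …, i_1 - 1]`. -/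
def basicInt (w : List ℕ) (a : X) : ℂ := iterInt a.1 w (2 * Real.pi)

/-- `a` belongs to the set of universal centers: all basic iterated integrals of order at least
one vanish at `a`. -/
def IsUniversalCenter (a : X) : Prop := ∀ w : List ℕ, w ≠ [] → basicInt w a = 0

/-- The relation `a ∼ b` on `X`. -/
def Equivalent (a b : X) : Prop := IsUniversalCenter (a * b⁻¹)

section Aux

lemma continuous_iterInt (a : X) (w : List ℕ) : Continuous (iterInt a.1 w) := by
  obtain ⟨a, ham, -, l, hl, ha⟩ := a
  induction w with
  | nil => exact continuous_const
  | cons j w ih =>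
    refine intervalIntegral.continuous_primitive (fun x y => ⟨?_, ?_⟩) 0
    · exact (ih.intervalIntegrable x y).1.bdd_mul (c := l ^ (j + 1))
        (ham j).aestronglyMeasurable (Filter.Eventually.of_forall fun x => ha j x)
    · exact (ih.intervalIntegrable x y).2.bdd_mul (c := l ^ (j + 1))
        (ham j).aestronglyMeasurable (Filter.Eventually.of_forall fun x => ha j x)

lemma intervalIntegrable_mul (a : X) (j : ℕ) {f : ℝ → ℂ} (hf : Continuous f) (x y : ℝ) :
    IntervalIntegrable (fun s => a.1 j s * f s) volume x y := by
  obtain ⟨a, ham, -, l, hl, ha⟩ := a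
  exact ⟨(hf.intervalIntegrable x y).1.bdd_mul (c := l ^ (j + 1))
      (ham j).aestronglyMeasurable (Filter.Eventually.of_forall fun x => ha j x),
    (hf.intervalIntegrable x y).2.bdd_mul (c := l ^ (j + 1))
      (ham j).aestronglyMeasurable (Filter.Eventually.of_forall fun x => ha j x)⟩

/-- Convolution of functions of words (sum over all splittings of a word). -/
def conv : (List ℕ → ℂ) → (List ℕ → ℂ) → List ℕ → ℂ
  | f, g, [] => f [] * g []
  | f, g, j :: w => f [] * g (j :: w) + conv (fun u => f (j :: u)) g w

lemma conv_add (f f' g : List ℕ → ℂ) (w : List ℕ) :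
    conv (fun u => f u + f' u) g w = conv f g w + conv f' g w := by
  induction w generalizing f f' with
  | nil => simp [conv]; ring
  | cons j w ih => simp only [conv, ih]; ring

lemma conv_smul (c : ℂ) (f g : List ℕ → ℂ) (w : List ℕ) :
    conv (fun u => c * f u) g w = c * conv f g w := by
  induction w generalizing f with
  | nil => simp [conv]; ring
  | cons j w ih => simp only [conv, ih]; ring

lemma conv_assoc (f g h : List ℕ → ℂ) (w : List ℕ) :
    conv (conv f g) h w = conv f (conv g h) w := by
  induction w generalizing f g with
  | nil => simp [conv]; ring
  | cons j w ih =>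
    simp only [conv, conv_add, conv_smul, ih]; ring

lemma continuous_conv {F : List ℕ → ℝ → ℂ} (hF : ∀ u, Continuous (F u)) (g : List ℕ → ℂ)
    (w : List ℕ) : Continuous fun s => conv (fun u => F u s) g w := by
  induction w generalizing F with
  | nil => simp only [conv]; exact (hF []).mul continuous_const
  | cons j w ih =>
    simp only [conv]
    exact ((hF []).mul continuous_const).add (ih fun u => hF (j :: u))

lemma integral_conv (a : X) (j : ℕ) {F : List ℕ → ℝ → ℂ} (hF : ∀ u, Continuous (F u))
    (g : List ℕ → ℂ) (w : List ℕ) (x : ℝ) :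
    conv (fun u => ∫ s in (0 : ℝ)..x, a.1 j s * F u s) g w =
      ∫ s in (0 : ℝ)..x, a.1 j s * conv (fun u => F u s) g w := by
  induction w generalizing F with
  | nil =>
    simp only [conv, ← intervalIntegral.integral_mul_const, mul_assoc]
  | cons k w ih =>
    simp only [conv]
    rw [ih fun u => hF (k :: u), ← intervalIntegral.integral_mul_const,
      ← intervalIntegral.integral_add]
    · congr 1; funext s; ring
    · exact (intervalIntegrable_mul a j (hF []) 0 x).mul_const _
    · exact intervalIntegrable_mul a j (continuous_conv (fun u => hF (k :: u)) g w) 0 x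

lemma mul_apply (a b : X) (j : ℕ) (t : ℝ) : (a * b).1 j t = concat (a.1 j) (b.1 j) t := rfl

lemma inv_apply (a : X) (j : ℕ) (t : ℝ) : (a⁻¹).1 j t = - a.1 j (2 * Real.pi - t) := rfl

lemma concat_left (a b : ℝ → ℂ) {t : ℝ} (h0 : 0 < t) (h1 : t ≤ Real.pi) :
    concat a b t = 2 * a (2 * t) := by
  rw [concat, angle_of_mem ⟨h0, by linarith⟩, if_pos h1]

lemma concat_right (a b : ℝ → ℂ) {t : ℝ} (h0 : Real.pi < t) (h1 : t ≤ 2 * Real.pi) :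
    concat a b t = 2 * b (2 * t - 2 * Real.pi) := by
  rw [concat, angle_of_mem ⟨by linarith [Real.pi_pos], h1⟩, if_neg (not_le.2 h0)]

lemma iterInt_mul_left (a b : X) (w : List ℕ) {x : ℝ} (h0 : 0 ≤ x) (h1 : x ≤ Real.pi) :
    iterInt (a * b).1 w x = iterInt a.1 w (2 * x) := by
  induction w generalizing x with
  | nil => rfl
  | cons j w ih =>
    have h : ∀ s ∈ Ioo 0 x, (a * b).1 j s * iterInt (a * b).1 w s =
        2 * (fun s => a.1 j s * iterInt a.1 w s) (2 * s) := by
      intro s hs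
      rw [ih hs.1.le (hs.2.le.trans h1), mul_apply, concat_left _ _ hs.1 (hs.2.le.trans h1)]
      ring
    simp only [iterInt]
    rw [intervalIntegral.integral_congr_Ioo_of_le h0 h, intervalIntegral.integral_const_mul,
      intervalIntegral.integral_comp_mul_left (fun s => a.1 j s * iterInt a.1 w s) two_ne_zero]
    simp

lemma iterInt_mul_right (a b : X) (w : List ℕ) {x : ℝ} (h0 : Real.pi ≤ x)
    (h1 : x ≤ 2 * Real.pi) :
    iterInt (a * b).1 w x =
      conv (fun u => iterInt b.1 u (2 * x - 2 * Real.pi)) (fun v => basicInt v a) w := by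
  induction w generalizing x with
  | nil => simp [iterInt, conv, basicInt]
  | cons j w ih =>
    have h : ∀ s ∈ Ioo Real.pi x, (a * b).1 j s * iterInt (a * b).1 w s =
        2 * (fun s => b.1 j s * conv (fun u => iterInt b.1 u s) (fun v => basicInt v a) w)
          (2 * s - 2 * Real.pi) := by
      intro s hs
      rw [ih hs.1.le (hs.2.le.trans h1), mul_apply, concat_right _ _ hs.1 (hs.2.le.trans h1)]
      ring
    have hl := iterInt_mul_left a b (j :: w) Real.pi_pos.le le_rfl
    have hc := continuous_iterInt (a * b) w
    simp only [conv]
    conv_rhs => enter [2]; simp only [iterInt]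
    rw [integral_conv b j (fun u => continuous_iterInt b u)]
    simp only [iterInt] at hl ⊢
    rw [← intervalIntegral.integral_add_adjacent_intervals
      (intervalIntegrable_mul (a * b) j hc 0 Real.pi)
      (intervalIntegrable_mul (a * b) j hc Real.pi x), hl,
      intervalIntegral.integral_congr_Ioo_of_le h0 h, intervalIntegral.integral_const_mul,
      intervalIntegral.integral_comp_mul_sub (fun s => b.1 j s *
        conv (fun u => iterInt b.1 u s) (fun v => basicInt v a) w) two_ne_zero]
    simp [basicInt, iterInt]

lemma basicInt_nil (a : X) : basicInt [] a = 1 := rfl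

lemma basicInt_mul (a b : X) (w : List ℕ) :
    basicInt w (a * b) = conv (fun u => basicInt u b) (fun v => basicInt v a) w := by
  have h := iterInt_mul_right a b w (x := 2 * Real.pi) (by linarith [Real.pi_pos]) le_rfl
  rw [basicInt, h]
  congr 1
  funext u
  rw [basicInt]; congr 1; ring

lemma inv_inv' (a : X) : (a⁻¹)⁻¹ = a := by
  obtain ⟨a, ha⟩ := a
  show X.mk _ _ = _
  congr 1
  funext j t
  simp [inv_apply]

lemma mul_inv_antisymm (a : X) (j : ℕ) {t : ℝ} (h0 : 0 < t) (h1 : t < Real.pi) :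
    (a * a⁻¹).1 j (2 * Real.pi - t) = - (a * a⁻¹).1 j t := by
  rw [mul_apply, mul_apply, concat_left _ _ h0 h1.le,
    concat_right _ _ (by linarith) (by linarith), inv_apply]
  have : 2 * Real.pi - (2 * (2 * Real.pi - t) - 2 * Real.pi) = 2 * t := by ring
  rw [this]; ring

lemma iterInt_symm (a : X) (w : List ℕ) {x : ℝ} (h0 : 0 ≤ x) (h1 : x ≤ Real.pi) :
    iterInt (a * a⁻¹).1 w (2 * Real.pi - x) = iterInt (a * a⁻¹).1 w x := by
  induction w generalizing x with
  | nil => rfl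
  | cons j w ih =>
    set c := a * a⁻¹ with hcdef
    have hi := intervalIntegrable_mul c j (continuous_iterInt c w)
    have h : ∀ s ∈ Ioo x Real.pi, c.1 j s * iterInt c.1 w s =
        - (fun s => c.1 j s * iterInt c.1 w s) (2 * Real.pi - s) := by
      intro s hs
      have hs0 : 0 < s := h0.trans_lt hs.1
      show _ = - (c.1 j (2 * Real.pi - s) * iterInt c.1 w (2 * Real.pi - s))
      rw [ih hs0.le hs.2.le, hcdef, mul_inv_antisymm a j hs0 hs.2]; ring
    have h2 : (∫ s in x..Real.pi, c.1 j s * iterInt c.1 w s) =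
        - ∫ s in Real.pi..(2 * Real.pi - x), c.1 j s * iterInt c.1 w s := by
      rw [intervalIntegral.integral_congr_Ioo_of_le h1 h, intervalIntegral.integral_neg,
        intervalIntegral.integral_comp_sub_left (fun s => c.1 j s * iterInt c.1 w s)]
      congr 2; ring
    simp only [iterInt]
    rw [← intervalIntegral.integral_add_adjacent_intervals (hi 0 x) (hi x (2 * Real.pi - x)),
      ← intervalIntegral.integral_add_adjacent_intervals (hi x Real.pi)
        (hi Real.pi (2 * Real.pi - x)), h2]
    ring

lemma isUniversalCenter_mul_inv (a : X) : IsUniversalCenter (a * a⁻¹) := by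
  intro w hw
  have h := iterInt_symm a w le_rfl Real.pi_pos.le
  rw [sub_zero] at h
  rw [basicInt, h]
  cases w with
  | nil => exact absurd rfl hw
  | cons j w => simp [iterInt]

lemma conv_cancel {f g g' : List ℕ → ℂ} (hf : f [] = 1)
    (h : ∀ w, conv f g w = conv f g' w) (w : List ℕ) : g w = g' w := by
  have key : ∀ (n : ℕ) (w : List ℕ), w.length ≤ n → (∀ v : List ℕ, v.length ≤ n → g v = g' v) →
      ∀ f, conv f g w = conv f g' w := by
    intro n w
    induction w with
    | nil => intro hn hv f; simp [conv, hv [] (by simp)]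
    | cons j w ih =>
      intro hn hv f
      simp only [conv]
      rw [hv _ hn, ih (by simp at hn; omega) hv]
  have main : ∀ n, ∀ w : List ℕ, w.length ≤ n → g w = g' w := by
    intro n
    induction n with
    | zero =>
      intro w hw
      have : w = [] := by simpa using hw
      subst this
      simpa [conv, hf] using h []
    | succ n ih =>
      intro w hw
      cases w with
      | nil => simpa [conv, hf] using h []
      | cons j w =>
        have h1 := h (j :: w)
        simp only [conv, hf, one_mul] at h1
        rw [key n w (by simpa using hw) ih] at h1
        exact add_right_cancel h1
  exact main _ w le_rfl

lemma equivalent_iff (a b : X) : Equivalent a b ↔ ∀ w, basicInt w a = basicInt w b := by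
  have e : ∀ c : X, (∀ w, basicInt w c = basicInt w (b * b⁻¹)) ↔ IsUniversalCenter c := by
    intro c
    constructor
    · intro h w hw
      rw [h, isUniversalCenter_mul_inv b w hw]
    · intro h w
      by_cases hw : w = []
      · subst hw; rfl
      · rw [h w hw, isUniversalCenter_mul_inv b w hw]
  rw [Equivalent, ← e]
  simp only [basicInt_mul]
  constructor
  · intro h w
    exact conv_cancel (f := fun u => basicInt u b⁻¹) rfl h w
  · intro h w
    rw [funext h]

lemma basicInt_zero (w : List ℕ) : basicInt w (0 : X) = if w = [] then 1 else 0 := by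
  cases w with
  | nil => rfl
  | cons j w => simp [basicInt, iterInt, show (0 : X).1 j = fun _ => 0 from rfl]

lemma basicInt_inv_congr {a b : X} (h : ∀ w, basicInt w a = basicInt w b) (w : List ℕ) :
    basicInt w a⁻¹ = basicInt w b⁻¹ := by
  have hb : ∀ c : X, ∀ w, conv (fun u => basicInt u c) (fun u => basicInt u c⁻¹) w =
      if w = [] then 1 else 0 := by
    intro c w
    rw [← basicInt_mul]
    split_ifs with hw
    · subst hw; rfl
    · have := isUniversalCenter_mul_inv c⁻¹ w hw
      rwa [inv_inv'] at this
  refine conv_cancel (f := fun u => basicInt u a) (g := fun u => basicInt u a⁻¹)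
    (g' := fun u => basicInt u b⁻¹) rfl (fun v => ?_) w
  rw [hb a, funext h, hb b]

end Aux

/-- `∼` is an equivalence relation on `X`. -/
instance setoidX : Setoid X where
  r := Equivalent
  iseqv :=
    { refl := fun a => (equivalent_iff a a).2 fun _ => rfl
      symm := fun h => (equivalent_iff _ _).2 fun w => ((equivalent_iff _ _).1 h w).symm
      trans := fun h h' => (equivalent_iff _ _).2 fun w =>
        ((equivalent_iff _ _).1 h w).trans ((equivalent_iff _ _).1 h' w) }

/-- The set `G(X)` of equivalence classes. -/
def G : Type := Quotient setoidX

/-- The class `[a]` of `a ∈ X`. -/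
def G.mk (a : X) : G := Quotient.mk setoidX a

lemma G.mk_eq_iff {a b : X} : G.mk a = G.mk b ↔ ∀ w, basicInt w a = basicInt w b :=
  Quotient.eq.trans (equivalent_iff a b)

/-- The group structure of `G(X)`: `[a] · [b] = [a * b]`, `1 = [0]`, `[a]⁻¹ = [a⁻¹]`. -/
instance : Group G where
  mul := Quotient.map₂ (· * ·) fun a a' ha b b' hb => by
    refine (equivalent_iff _ _).2 fun w => ?_
    rw [basicInt_mul, basicInt_mul, funext ((equivalent_iff _ _).1 ha),
      funext ((equivalent_iff _ _).1 hb)]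
  one := G.mk 0
  inv := Quotient.map (·⁻¹) fun a b hab =>
    (equivalent_iff _ _).2 (basicInt_inv_congr ((equivalent_iff a b).1 hab))
  mul_assoc := by
    rintro ⟨a⟩ ⟨b⟩ ⟨c⟩
    refine G.mk_eq_iff.2 fun w => ?_
    rw [basicInt_mul, basicInt_mul, funext (basicInt_mul a b), funext (basicInt_mul b c)]
    exact (conv_assoc _ _ _ w).symm
  one_mul := by
    rintro ⟨a⟩
    refine G.mk_eq_iff.2 fun w => ?_
    have h1 : ∀ (w : List ℕ) (f : List ℕ → ℂ),
        conv f (fun v => if v = [] then 1 else 0) w = f w := by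
      intro w
      induction w with
      | nil => intro f; simp [conv]
      | cons j w ih => intro f; simp [conv, ih]
    rw [basicInt_mul, funext basicInt_zero, h1]
  mul_one := by
    rintro ⟨a⟩
    refine G.mk_eq_iff.2 fun w => ?_
    have h2 : ∀ (w : List ℕ) (g : List ℕ → ℂ), conv (fun _ => 0) g w = 0 := by
      intro w
      induction w with
      | nil => intro g; simp [conv]
      | cons j w ih => intro g; simp [conv, ih]
    rw [basicInt_mul, funext basicInt_zero]
    cases w with
    | nil => simp [conv]
    | cons j w => simp [conv, h2]
  inv_mul_cancel := by
    rintro ⟨a⟩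
    refine G.mk_eq_iff.2 fun w => ?_
    by_cases hw : w = []
    · subst hw; rfl
    · have := isUniversalCenter_mul_inv a⁻¹ w hw
      rw [inv_inv'] at this
      exact this.trans (by rw [basicInt_zero, if_neg hw])

/-- The basic iterated integrals as functions on `G(X)`. -/
def G.basicInt (w : List ℕ) : G → ℂ :=
  Quotient.lift (CenterProblem.basicInt w) fun a b h => (equivalent_iff a b).1 h w

/-- The topology `τ`: the weakest one in which all iterated integrals are continuous. -/
instance : TopologicalSpace G :=
  ⨅ w : List ℕ, TopologicalSpace.induced (G.basicInt w) inferInstance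

/-! ### Convergent power series -/

/-- The set `G_c[[r]]` of complex power series `r + ∑_{k ≥ 1} d_k r^{k+1}` that converge in a
neighbourhood of `0`. -/
structure Gc : Type where
  series : PowerSeries ℂ
  coeff_zero : PowerSeries.coeff 0 series = 0
  coeff_one : PowerSeries.coeff 1 series = 1
  converges : ∃ ρ : ℝ, 0 < ρ ∧
    ∀ z : ℂ, ‖z‖ < ρ → Summable fun n => PowerSeries.coeff n series * z ^ n

/-- The coefficient `d_k` of `r^{k+1}`. -/
def Gc.d (k : ℕ) (f : Gc) : ℂ := PowerSeries.coeff (k + 1) f.series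

/-- The topology `τ'`: the weakest one in which all `d_k`, `k = 1, 2, …`, are continuous. -/
instance : TopologicalSpace Gc :=
  ⨅ k : ℕ, TopologicalSpace.induced (Gc.d (k + 1)) inferInstance

/-- The unit of `G_c[[r]]`: the series `f(r) = r`. -/
instance : One Gc where
  one := ⟨PowerSeries.X, by simp, by simp, 1, one_pos, fun z _ =>
    summable_of_ne_finset_zero (s := {1}) fun n hn => by
      rw [PowerSeries.coeff_X, if_neg (by simpa using hn), zero_mul]⟩

/-! ### The first return map -/

/-- `v` is a Lipschitz solution on `[0, 2π]` of `dv/dx = ∑_{i ≥ 1} a_i(x) v^{i+1}`, `v(0) = r`: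
the equation (including convergence of the series) holds almost everywhere. -/
def IsSolution (a : X) (r : ℂ) (v : ℝ → ℂ) : Prop :=
  (∃ K : NNReal, LipschitzOnWith K v (Icc 0 (2 * Real.pi))) ∧ v 0 = r ∧
    ∀ᵐ x ∂(volume.restrict (Icc 0 (2 * Real.pi))), ∃ v' : ℂ,
      HasSum (fun i : ℕ => a.1 i x * v x ^ (i + 2)) v' ∧ HasDerivAt v v' x

/-- `f` is the first return map `r ↦ v(2π; r; a)`: for all sufficiently small `r` there is a
Lipschitz solution with initial value `r`, and every such solution satisfies `v(2π) = f(r)`, the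
sum of the series `f` at `r`. -/
def IsFirstReturnMap (a : X) (f : Gc) : Prop :=
  ∃ ρ : ℝ, 0 < ρ ∧ ∀ r : ℂ, ‖r‖ < ρ → (∃ v, IsSolution a r v) ∧
    ∀ v, IsSolution a r v → HasSum (fun n => PowerSeries.coeff n f.series * r ^ n) (v (2 * Real.pi))

/-- The map `P̂ : G(X) → G_c[[r]]`, `P̂([a]) = P(a)`: the series which is the first return map of
every representative of the given class. -/
def Phat (g : G) : Gc :=
  @Classical.epsilon Gc ⟨1⟩ fun f => ∀ a : X, G.mk a = g → IsFirstReturnMap a f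

/-- The kernel `Ĉ` of `P̂`, with the topology induced from `G(X)`. -/
def Chat : Set G := {g | Phat g = 1}

/-! ### The map `T` -/

/-- The series `∑_{k ≥ 1} (d_k / 2π) t^{k+1}`. -/
def numSeries (f : Gc) : PowerSeries ℂ :=
  PowerSeries.mk fun n => if n ≤ 1 then 0 else f.d (n - 1) / (2 * Real.pi)

/-- The series `1 + ∑_{k ≥ 1} (k+1) d_k (1 - x/2π) t^k`. -/
def denSeries (f : Gc) (x : ℝ) : PowerSeries ℂ :=
  PowerSeries.mk fun k =>
    if k = 0 then 1 else ((k : ℂ) + 1) * f.d k * (1 - (x : ℂ) / (2 * Real.pi))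

section Aux

lemma Gc.exists_bound (f : Gc) : ∃ M : ℝ, 0 < M ∧ ∀ k, 1 ≤ k → ‖f.d k‖ ≤ M ^ k := by
  obtain ⟨ρ, hρ, h⟩ := f.converges
  have hs := h ((ρ / 2 : ℝ) : ℂ) (by
    rw [Complex.norm_real, Real.norm_of_nonneg (by positivity)]; linarith)
  obtain ⟨C, hC⟩ := hs.tendsto_atTop_zero.norm.bddAbove_range
  set s := ρ / 2 with hsdef
  have hs0 : 0 < s := by positivity
  set D := max 1 (C / s) with hD
  have hD1 : 1 ≤ D := le_max_left _ _
  refine ⟨D / s, by positivity, fun k hk => ?_⟩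
  have h1 : ‖f.d k‖ * s ^ (k + 1) ≤ C := by
    have := hC ⟨k + 1, rfl⟩
    simpa [Gc.d, norm_mul, norm_pow, abs_of_pos hs0] using this
  have h2 : C ≤ D * s := by
    rw [← div_le_iff₀ hs0]; exact le_max_right _ _
  have h3 : ‖f.d k‖ * s ^ k ≤ D := by
    have : ‖f.d k‖ * s ^ k * s ≤ D * s := by
      rw [mul_assoc, ← pow_succ]; exact h1.trans h2
    exact le_of_mul_le_mul_right this hs0
  rw [div_pow, le_div_iff₀ (by positivity)]
  exact h3.trans (le_self_pow₀ hD1 (by omega))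

lemma constantCoeff_denSeries (f : Gc) (x : ℝ) :
    PowerSeries.constantCoeff (denSeries f x) = 1 := by
  rw [← PowerSeries.coeff_zero_eq_constantCoeff_apply]; simp [denSeries]

lemma coeff_denSeries_inv (f : Gc) (x : ℝ) (n : ℕ) :
    PowerSeries.coeff n (denSeries f x)⁻¹ = if n = 0 then 1 else
      -∑ p ∈ Finset.HasAntidiagonal.antidiagonal n, if p.2 < n then
        PowerSeries.coeff p.1 (denSeries f x) * PowerSeries.coeff p.2 (denSeries f x)⁻¹
      else 0 := by
  rw [PowerSeries.coeff_inv, constantCoeff_denSeries]; simp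

lemma continuous_coeff_denSeries (f : Gc) (n : ℕ) :
    Continuous fun x => PowerSeries.coeff n (denSeries f x) := by
  simp only [denSeries, PowerSeries.coeff_mk]
  split_ifs <;> fun_prop

lemma continuous_coeff_denSeries_inv (f : Gc) (n : ℕ) :
    Continuous fun x => PowerSeries.coeff n (denSeries f x)⁻¹ := by
  induction n using Nat.strong_induction_on with
  | _ n ih =>
    simp only [coeff_denSeries_inv f _ n]
    split_ifs with hn
    · exact continuous_const
    · refine (continuous_finsetSum _ fun p _ => ?_).neg
      split_ifs with hp
      · exact (continuous_coeff_denSeries f p.1).mul (ih p.2 hp)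
      · exact continuous_const

lemma norm_coeff_denSeries_le {f : Gc} {M : ℝ} (hM : 0 < M)
    (h : ∀ k, 1 ≤ k → ‖f.d k‖ ≤ M ^ k) {x : ℝ} (hx : x ∈ Ioc 0 (2 * Real.pi)) (n : ℕ) :
    ‖PowerSeries.coeff n (denSeries f x)‖ ≤ (2 * M) ^ n := by
  simp only [denSeries, PowerSeries.coeff_mk]
  split_ifs with hn
  · simp [hn]
  · have h1 : ‖(n : ℂ) + 1‖ ≤ 2 ^ n := by
      have : (n : ℝ) + 1 ≤ 2 ^ n := by exact_mod_cast Nat.lt_two_pow_self (n := n)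
      refine le_trans (le_of_eq ?_) this
      rw [show (n : ℂ) + 1 = ((n + 1 : ℝ) : ℂ) by push_cast; rfl, Complex.norm_real,
        Real.norm_of_nonneg (by positivity)]
    have h2 : ‖(1 : ℂ) - (x : ℂ) / (2 * Real.pi)‖ ≤ 1 := by
      rw [show (1 : ℂ) - (x : ℂ) / (2 * Real.pi) = ((1 - x / (2 * Real.pi) : ℝ) : ℂ) by
        push_cast; rfl, Complex.norm_real, Real.norm_eq_abs, abs_le]
      have hp := Real.two_pi_pos
      have h3 : 0 < x / (2 * Real.pi) := div_pos hx.1 hp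
      have h4 : x / (2 * Real.pi) ≤ 1 := (div_le_one hp).2 hx.2
      constructor <;> linarith
    rw [norm_mul, norm_mul, mul_pow]
    calc _ ≤ 2 ^ n * M ^ n * 1 := by
          gcongr
          exact h n (by omega)
      _ = _ := mul_one _

lemma norm_coeff_denSeries_inv_le {f : Gc} {M : ℝ} (hM : 0 < M)
    (h : ∀ k, 1 ≤ k → ‖f.d k‖ ≤ M ^ k) {x : ℝ} (hx : x ∈ Ioc 0 (2 * Real.pi)) (n : ℕ) :
    ‖PowerSeries.coeff n (denSeries f x)⁻¹‖ ≤ (4 * M) ^ n := by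
  induction n using Nat.strong_induction_on with
  | _ n ih =>
    rw [coeff_denSeries_inv]
    split_ifs with hn
    · simp [hn]
    · rw [norm_neg, ← Finset.Nat.sum_antidiagonal_swap,
        Finset.Nat.sum_antidiagonal_eq_sum_range_succ_mk, Finset.sum_range_succ]
      simp only [Prod.swap_prod_mk, lt_irrefl, if_false, add_zero]
      refine (norm_sum_le _ _).trans ?_
      have : ∀ j ∈ Finset.range n, ‖(if j < n then
          PowerSeries.coeff (n - j) (denSeries f x) *
            PowerSeries.coeff j (denSeries f x)⁻¹ else 0)‖ ≤
          (2 * M) ^ n * 2 ^ j := by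
        intro j hj
        have hj' := Finset.mem_range.1 hj
        rw [if_pos hj', norm_mul]
        calc _ ≤ (2 * M) ^ (n - j) * (4 * M) ^ j :=
              mul_le_mul (norm_coeff_denSeries_le hM h hx _) (ih j hj') (norm_nonneg _)
                (by positivity)
          _ = (2 * M) ^ (n - j) * (2 * M) ^ j * 2 ^ j := by
              rw [show 4 * M = 2 * M * 2 by ring, mul_pow (2 * M) 2 j, mul_assoc]
          _ = _ := by rw [← pow_add]; congr 2; omega
      refine (Finset.sum_le_sum this).trans ?_
      rw [← Finset.mul_sum, geom_sum_eq (by norm_num)]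
      rw [show 4 * M = 2 * M * 2 by ring, mul_pow (2 * M) 2 n]
      gcongr
      norm_num

lemma norm_coeff_numSeries_le {f : Gc} {M : ℝ} (hM : 0 < M)
    (h : ∀ k, 1 ≤ k → ‖f.d k‖ ≤ M ^ k) (n : ℕ) :
    ‖PowerSeries.coeff n (numSeries f)‖ ≤ (4 * M) ^ (n - 1) := by
  simp only [numSeries, PowerSeries.coeff_mk]
  split_ifs with hn
  · rw [norm_zero]; positivity
  · have h1 : 1 ≤ ‖(2 : ℂ) * Real.pi‖ := by
      rw [norm_mul, Complex.norm_ofNat, Complex.norm_real, Real.norm_of_nonneg Real.pi_pos.le]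
      linarith [Real.pi_gt_three]
    rw [norm_div]
    refine (div_le_self (norm_nonneg _) h1).trans ((h _ (by omega)).trans ?_)
    gcongr; linarith

lemma isCoeff_genSeries (f : Gc) : IsCoeff fun i t =>
    PowerSeries.coeff (i + 2) (numSeries f * (denSeries f (angle t))⁻¹) := by
  obtain ⟨M, hM, h⟩ := f.exists_bound
  refine ⟨fun i => ?_, fun i t => by simp only [angle_periodic t], 16 * M, by positivity,
    fun i t => ?_⟩
  · refine Continuous.measurable (f := fun x => PowerSeries.coeff (i + 2)
      (numSeries f * (denSeries f x)⁻¹)) ?_ |>.comp measurable_angle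
    simp only [PowerSeries.coeff_mul]
    exact continuous_finsetSum _ fun p _ =>
      continuous_const.mul (continuous_coeff_denSeries_inv f p.2)
  · show ‖PowerSeries.coeff (i + 2) (numSeries f * (denSeries f (angle t))⁻¹)‖ ≤ _
    rw [PowerSeries.coeff_mul]
    have key : ∀ p ∈ Finset.HasAntidiagonal.antidiagonal (i + 2), ‖PowerSeries.coeff p.1 (numSeries f) *
        PowerSeries.coeff p.2 (denSeries f (angle t))⁻¹‖ ≤ (4 * M) ^ (i + 1) := by
      intro p hp
      rw [Finset.HasAntidiagonal.mem_antidiagonal] at hp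
      by_cases h0 : p.1 = 0
      · rw [h0]; simp [numSeries]; positivity
      · rw [norm_mul, show i + 1 = (p.1 - 1) + p.2 by omega, pow_add]
        exact mul_le_mul (norm_coeff_numSeries_le hM h _)
          (norm_coeff_denSeries_inv_le hM h (angle_mem t) _) (norm_nonneg _) (by positivity)
    refine (norm_sum_le _ _).trans ((Finset.sum_le_sum key).trans ?_)
    rw [Finset.sum_const, Finset.Nat.card_antidiagonal, nsmul_eq_mul,
      show 16 * M = 4 * (4 * M) by ring, mul_pow 4 (4 * M)]
    gcongr
    have : ∀ i : ℕ, i + 2 + 1 ≤ 4 ^ (i + 1) := by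
      intro i
      induction i with
      | zero => norm_num
      | succ i ih => rw [pow_succ]; omega
    exact_mod_cast this i

end Aux

/-- The element `a(f)` of `X`, defined by the identity of formal power series
`∑_{i ≥ 1} a_i(x) t^{i+1} = (∑_{k ≥ 1} (d_k / 2π) t^{k+1}) / (1 + ∑_{k ≥ 1} (k+1) d_k (1 - x/2π) t^k)`
for `x ∈ (0, 2π]` and extended by periodicity. -/
def coeffOf (f : Gc) : X :=
  ⟨fun i t => PowerSeries.coeff (i + 2) (numSeries f * (denSeries f (angle t))⁻¹),
    isCoeff_genSeries f⟩

/-- The map `T(f) = [a(f)]`. -/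
def T (f : Gc) : G := G.mk (coeffOf f)

end CenterProblem

end

/-! Write a solution with `v(0) = r` as a power series in `r`. Since `(v^m)' = m ∑ a_i v^(m+i)`, the
coefficient of `r^n` in `v^m` is obtained by integrating `a_i` against the coefficients of `r^n` in
the higher powers `v^(m+i)`. Unwinding this recursion (`flowCoeff`) gives a finite linear
combination of iterated integrals. Hence the coefficients of `P(a)` are universal linear functionals
of the basic iterated integrals, so `P(a)` depends only on `[a]` and `P̂` is continuous. Convergence
and the remainder estimate (`norm_flowCoeff_le`, `IsSolution.norm_pow_sub_sum_le`) use the weight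
`exp(n x)`: its integral gains a factor `1/n`, which cancels the factor `m ≤ n` of the recursion.
Existence of solutions for small `r` is Picard iteration.

A solution for `a * b` runs through a solution for `a` and then one for `b`, each at double speed,
so `P̂(g h) = P̂(h) ∘ P̂(g)` near `0` (`eval_Phat_mul`).

The equation of `a(f)` is built so that `(1 - x/2π) f(v) + (x/2π) v` is conserved. Comparing `x = 0`
with `x = 2π` gives `v(2π) = f(r)`, that is, `P̂ ∘ T = id` (`Phat_T`). `T` is continuous because the
coefficients of `a(f)` are polynomials in finitely many `d_k`, with continuous dependence on `x`;
having a continuous left inverse, it is an embedding. Since `G(X)` is a topological group, `g ↦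
(P̂(g), T(P̂(g))⁻¹ g)` is a continuous inverse of `T̃`. -/

noncomputable section

namespace CenterProblem

/-! ### Formal expansion of the flow in iterated integrals -/

/-- The coefficient of `r ^ (m + k)` in the `m`-th power of a solution with initial value `r`,
as a linear functional of the family `J` of iterated integrals. -/
def flowCoeff : ℕ → ℕ → (List ℕ → ℂ) → ℂ
  | 0, _, J => J []
  | k + 1, m, J => m * ∑ j : Fin (k + 1), flowCoeff (k - j) (m + j + 1) fun w => J (j.1 :: w)
termination_by k => k
decreasing_by omega

lemma flowCoeff_zero (m : ℕ) (J : List ℕ → ℂ) : flowCoeff 0 m J = J [] := by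
  rw [flowCoeff]

lemma flowCoeff_succ (k m : ℕ) (J : List ℕ → ℂ) :
    flowCoeff (k + 1) m J =
      m * ∑ j ∈ Finset.range (k + 1), flowCoeff (k - j) (m + j + 1) fun w => J (j :: w) := by
  rw [flowCoeff, Finset.sum_range]

lemma continuous_flowCoeff {S : Type*} [TopologicalSpace S] (k m : ℕ) {F : List ℕ → S → ℂ}
    (hF : ∀ w, Continuous (F w)) : Continuous fun s => flowCoeff k m fun w => F w s := by
  induction k using Nat.strong_induction_on generalizing m F with
  | _ k ih =>
    cases k with
    | zero => simpa only [flowCoeff_zero] using hF []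
    | succ k =>
      simp only [flowCoeff_succ]
      exact continuous_const.mul (continuous_finsetSum _ fun j _ =>
        ih (k - j) (by omega) (m + j + 1) fun w => hF (j :: w))

/-- `flowCoeff` is a finite linear combination of values of its argument, so it commutes with
integration. Applied to words with a first letter split off, this turns the algebraic recursion into
an integral recursion in `x`. -/
lemma flowCoeff_integral (a : X) (i k m : ℕ) {F : List ℕ → ℝ → ℂ} (hF : ∀ w, Continuous (F w))
    (x : ℝ) :
    (flowCoeff k m fun w => ∫ s in (0 : ℝ)..x, a.1 i s * F w s) =
      ∫ s in (0 : ℝ)..x, a.1 i s * flowCoeff k m fun w => F w s := by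
  induction k using Nat.strong_induction_on generalizing m F with
  | _ k ih =>
    cases k with
    | zero => simp only [flowCoeff_zero]
    | succ k =>
      simp only [flowCoeff_succ]
      rw [Finset.sum_congr rfl fun j _ =>
        ih (k - j) (by omega) (m + j + 1) (F := fun w => F (j :: w)) fun w => hF (j :: w),
        ← intervalIntegral.integral_finsetSum, ← intervalIntegral.integral_const_mul]
      · congr 1
        funext s
        rw [← Finset.mul_sum]; ring
      · exact fun j _ => intervalIntegrable_mul a i
          (continuous_flowCoeff _ _ fun w => hF (j :: w)) 0 x

lemma flowCoeff_succ_iterInt (a : X) (k m : ℕ) (x : ℝ) :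
    (flowCoeff (k + 1) m fun w => iterInt a.1 w x) =
      m * ∑ j ∈ Finset.range (k + 1), ∫ s in (0 : ℝ)..x,
        a.1 j s * flowCoeff (k - j) (m + j + 1) fun w => iterInt a.1 w s := by
  rw [flowCoeff_succ]
  congr 1
  refine Finset.sum_congr rfl fun j _ => ?_
  simp only [iterInt]
  exact flowCoeff_integral a j _ _ (continuous_iterInt a) x

lemma integral_exp_nat_mul_le {n : ℕ} (hn : 0 < n) (x : ℝ) :
    n * ∫ s in (0 : ℝ)..x, Real.exp (n * s) ≤ Real.exp (n * x) := by
  have hn' : (n : ℝ) ≠ 0 := by positivity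
  rw [intervalIntegral.integral_comp_mul_left _ hn', integral_exp, smul_eq_mul, ← mul_assoc,
    mul_inv_cancel₀ hn', one_mul]
  simp

lemma norm_integral_mul_exp_le {n : ℕ} (hn : 0 < n) {x : ℝ} (hx : 0 ≤ x) {f : ℝ → ℂ} {C : ℝ}
    (hC : 0 ≤ C) (hf : ∀ᵐ s, s ∈ Ioc 0 x → ‖f s‖ ≤ C * Real.exp (n * s)) :
    n * ‖∫ s in (0 : ℝ)..x, f s‖ ≤ C * Real.exp (n * x) := by
  have h := intervalIntegral.norm_integral_le_of_norm_le hx hf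
    (Continuous.intervalIntegrable (by fun_prop) 0 x)
  rw [intervalIntegral.integral_const_mul] at h
  calc n * ‖∫ s in (0 : ℝ)..x, f s‖ ≤ n * (C * ∫ s in (0 : ℝ)..x, Real.exp (n * s)) := by gcongr
    _ = C * (n * ∫ s in (0 : ℝ)..x, Real.exp (n * s)) := by ring
    _ ≤ _ := by gcongr; exact integral_exp_nat_mul_le hn x

lemma sum_half_pow_le (n : ℕ) : ∑ j ∈ Finset.range n, (1 / 2 : ℝ) ^ (j + 1) ≤ 1 := by
  have h : ∑ j ∈ Finset.range n, (1 / 2 : ℝ) ^ (j + 1) = 1 - (1 / 2) ^ n := by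
    induction n with
    | zero => simp
    | succ n ih => rw [Finset.sum_range_succ, ih]; ring
  rw [h]
  have : (0 : ℝ) ≤ (1 / 2) ^ n := by positivity
  linarith

lemma hasSum_half_pow : HasSum (fun j : ℕ => (1 / 2 : ℝ) ^ (j + 1)) 1 := by
  have := hasSum_geometric_two.mul_left (1 / 2)
  norm_num at this
  simpa [pow_succ, mul_comm] using this

/-- The weight `exp((m + k) x)` is what prevents the product of the prefactors `m` from growing
factorially: each integration of the weight divides by `m + k`. -/
lemma norm_flowCoeff_le {a : X} {l : ℝ} (hl : 0 < l) (ha : ∀ i x, ‖a.1 i x‖ ≤ l ^ (i + 1))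
    (k m : ℕ) {x : ℝ} (hx : 0 ≤ x) :
    ‖flowCoeff k m fun w => iterInt a.1 w x‖ ≤ (2 * l) ^ k * Real.exp ((m + k : ℕ) * x) := by
  induction k using Nat.strong_induction_on generalizing m x with
  | _ k ih =>
    cases k with
    | zero =>
      rw [flowCoeff_zero, iterInt, norm_one, pow_zero, one_mul]
      exact Real.one_le_exp (by positivity)
    | succ k =>
      -- The total degree `n` is invariant under the recursion, as `(m + j + 1) + (k - j) = n`. All
      -- integrands therefore carry the same exponential, and `1/n` compensates the prefactor `m ≤
      -- n`.
      set n := m + (k + 1) with hn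
      have hn0 : 0 < n := by omega
      have hmn : (m : ℝ) ≤ n := by exact_mod_cast (by omega : m ≤ n)
      have key : ∀ j ∈ Finset.range (k + 1), n * ‖∫ s in (0 : ℝ)..x,
          a.1 j s * flowCoeff (k - j) (m + j + 1) fun w => iterInt a.1 w s‖ ≤
          (1 / 2) ^ (j + 1) * ((2 * l) ^ (k + 1) * Real.exp (n * x)) := by
        intro j hj
        have hj := Finset.mem_range.1 hj
        rw [← mul_assoc]
        refine norm_integral_mul_exp_le hn0 hx (by positivity) (.of_forall fun s hs => ?_)
        rw [norm_mul]
        calc _ ≤ l ^ (j + 1) * ((2 * l) ^ (k - j) * Real.exp ((m + j + 1 + (k - j) : ℕ) * s)) :=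
              mul_le_mul (ha j s) (ih (k - j) (by omega) (m + j + 1) hs.1.le) (norm_nonneg _)
                (by positivity)
          _ = _ := by
              rw [show m + j + 1 + (k - j) = n by omega, ← mul_assoc]
              congr 1
              rw [show k + 1 = (j + 1) + (k - j) by omega, pow_add (2 * l), ← mul_assoc, ← mul_pow]
              congr 2; ring
      rw [flowCoeff_succ_iterInt, norm_mul, Complex.norm_natCast]
      calc _ ≤ n * ∑ j ∈ Finset.range (k + 1), ‖∫ s in (0 : ℝ)..x,
          a.1 j s * flowCoeff (k - j) (m + j + 1) fun w => iterInt a.1 w s‖ := by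
            gcongr; exact norm_sum_le _ _
        _ ≤ ∑ j ∈ Finset.range (k + 1),
            (1 / 2) ^ (j + 1) * ((2 * l) ^ (k + 1) * Real.exp (n * x)) := by
            rw [Finset.mul_sum]; exact Finset.sum_le_sum key
        _ ≤ 1 * ((2 * l) ^ (k + 1) * Real.exp (n * x)) := by
            rw [← Finset.sum_mul]; gcongr; exact sum_half_pow_le _
        _ = _ := one_mul _

/-! ### Lipschitz functions -/

lemma lipschitzOnWith_integral {g : ℝ → ℂ} {K : NNReal} {b : ℝ}
    (hi : IntervalIntegrable g volume 0 b)
    (hg : ∀ᵐ s, s ∈ Ioc 0 b → ‖g s‖ ≤ K) :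
    LipschitzOnWith K (fun x => ∫ s in (0 : ℝ)..x, g s) (Icc 0 b) := by
  have key : ∀ y ∈ Icc 0 b, ∀ z ∈ Icc 0 b, y ≤ z →
      dist (∫ s in (0 : ℝ)..z, g s) (∫ s in (0 : ℝ)..y, g s) ≤ K * dist z y := by
    intro y hy z hz hyz
    have hb : (0 : ℝ) ≤ b := hy.1.trans hy.2
    rw [dist_eq_norm, intervalIntegral.integral_interval_sub_left, Real.dist_eq]
    · refine intervalIntegral.norm_integral_le_of_norm_le_const_ae ?_
      filter_upwards [hg] with s hs hsy
      rw [uIoc_of_le hyz] at hsy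
      exact hs ⟨hy.1.trans_lt hsy.1, hsy.2.trans hz.2⟩
    · exact hi.mono_set (by rw [uIcc_of_le hz.1, uIcc_of_le hb]; exact Icc_subset_Icc_right hz.2)
    · exact hi.mono_set (by rw [uIcc_of_le hy.1, uIcc_of_le hb]; exact Icc_subset_Icc_right hy.2)
  refine LipschitzOnWith.of_dist_le_mul fun y hy z hz => ?_
  rcases le_total y z with h | h
  · rw [dist_comm, dist_comm y]; exact key y hy z hz h
  · exact key z hz y hy h

lemma norm_le_of_lipschitzOnWith_of_hasDerivAt {f : ℝ → ℂ} {K : NNReal} {b : ℝ}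
    (hf : LipschitzOnWith K f (Icc 0 b)) {s : ℝ} (hs : s ∈ Ioo 0 b) {f' : ℂ}
    (hd : HasDerivAt f f' s) : ‖f'‖ ≤ K := by
  have := norm_deriv_le_of_lipschitzOn (Icc_mem_nhds hs.1 hs.2) hf
  rwa [hd.deriv] at this

/-- The fundamental theorem of calculus for complex-valued Lipschitz functions. -/
lemma sub_eq_integral_of_lipschitzOnWith {f g : ℝ → ℂ} {K : NNReal} {b : ℝ} (hb : 0 ≤ b)
    (hf : LipschitzOnWith K f (Icc 0 b))
    (hd : ∀ᵐ s, s ∈ Ioo 0 b → HasDerivAt f (g s) s) :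
    IntervalIntegrable g volume 0 b ∧ f b - f 0 = ∫ s in (0 : ℝ)..b, g s := by
  have hae : ∀ᵐ s : ℝ, s ∈ Ioc 0 b → s ∈ Ioo 0 b := by
    filter_upwards [Measure.ae_ne volume b] with s hs h
    exact ⟨h.1, lt_of_le_of_ne h.2 hs⟩
  have hd' : ∀ᵐ s, s ∈ Ioc 0 b → HasDerivAt f (g s) s := by
    filter_upwards [hd, hae] with s h1 h2 h using h1 (h2 h)
  have hbd : ∀ᵐ s, s ∈ Ioc 0 b → ‖g s‖ ≤ K := by
    filter_upwards [hd, hae] with s h1 h2 h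
    exact norm_le_of_lipschitzOnWith_of_hasDerivAt hf (h2 h) (h1 (h2 h))
  -- Measurability of `g` comes from that of `deriv f`, with which it agrees almost everywhere; the
  -- Lipschitz constant bounds it.
  have hi : IntervalIntegrable g volume 0 b := by
    rw [intervalIntegrable_iff_integrableOn_Ioc_of_le hb]
    refine IntegrableOn.of_bound measure_Ioc_lt_top ?_ K
      ((ae_restrict_iff' measurableSet_Ioc).2 hbd)
    refine (measurable_deriv f).aestronglyMeasurable.congr ?_
    refine (ae_restrict_iff' measurableSet_Ioc).2 ?_
    filter_upwards [hd'] with s hs h using (hs h).deriv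
  refine ⟨hi, ?_⟩
  -- The difference of `f` and the primitive of `g` is Lipschitz with derivative zero almost
  -- everywhere; absolute continuity makes it constant.
  have hL : LipschitzOnWith (K + K) (fun x => f x - ∫ s in (0 : ℝ)..x, g s) (uIcc 0 b) := by
    rw [uIcc_of_le hb]
    exact hf.sub (lipschitzOnWith_integral hi hbd)
  obtain ⟨C, hC⟩ := hL.absolutelyContinuousOnInterval.const_of_ae_hasDerivAt_zero (by
    filter_upwards [hi.ae_hasDerivAt_integral, hd', Measure.ae_ne volume 0] with s h1 h2 h3 hs
    have h4 : s ∈ Ioc 0 b := by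
      rw [uIcc_of_le hb] at hs
      exact ⟨lt_of_le_of_ne hs.1 (Ne.symm h3), hs.2⟩
    have := (h2 h4).fun_sub (h1 hs 0 left_mem_uIcc)
    rwa [sub_self] at this)
  have e := (hC b right_mem_uIcc).trans (hC 0 left_mem_uIcc).symm
  simp only [intervalIntegral.integral_same, sub_zero] at e
  linear_combination e

lemma norm_pow_sub_pow_le {z w : ℂ} {δ : ℝ} (hz : ‖z‖ ≤ δ) (hw : ‖w‖ ≤ δ) (m : ℕ) :
    ‖z ^ m - w ^ m‖ ≤ m * δ ^ (m - 1) * ‖z - w‖ := by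
  rw [← (Commute.all z w).geom_sum₂_mul, norm_mul]
  refine mul_le_mul_of_nonneg_right ?_ (norm_nonneg _)
  refine (norm_sum_le _ _).trans ?_
  have h : ∀ i ∈ Finset.range m, ‖z ^ i * w ^ (m - 1 - i)‖ ≤ δ ^ (m - 1) := by
    intro i hi
    have hi := Finset.mem_range.1 hi
    rw [norm_mul, norm_pow, norm_pow, show m - 1 = i + (m - 1 - i) by omega, pow_add,
      show i + (m - 1 - i) - i = m - 1 - i by omega]
    have := (norm_nonneg z).trans hz
    gcongr
  refine (Finset.sum_le_sum h).trans ?_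
  simp

/-! ### A priori bounds and expansion of solutions -/

section Solutions

variable {a : X} {l δ : ℝ} {r : ℂ} {v : ℝ → ℂ}

/-- The majorant is arranged so that its `j`-dependent part `(1/2)^(j+1)` sums to exactly `1`. -/
lemma norm_coeff_mul_pow_le (hl : 0 < l) (ha : ∀ i x, ‖a.1 i x‖ ≤ l ^ (i + 1))
    (hδ : 0 ≤ δ) (hlδ : 2 * l * δ ≤ 1) (m j : ℕ) (x : ℝ) {z : ℂ} (hz : ‖z‖ ≤ δ) :
    ‖a.1 j x * z ^ (m + j + 1)‖ ≤ δ ^ m * (2 * l * δ) * (1 / 2) ^ (j + 1) := by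
  rw [norm_mul, norm_pow]
  calc _ ≤ l ^ (j + 1) * δ ^ (m + j + 1) := by gcongr; exact ha j x
    _ = δ ^ m * (2 * l * δ) ^ (j + 1) * (1 / 2) ^ (j + 1) := by
        rw [mul_assoc (δ ^ m), ← mul_pow, show 2 * l * δ * (1 / 2) = l * δ by ring, mul_pow]; ring
    _ ≤ _ := by
        gcongr
        exact pow_le_of_le_one (by positivity) hlδ (by omega)

lemma IsSolution.ae_hasDerivAt (h : IsSolution a r v) :
    ∀ᵐ s, s ∈ Ioo 0 (2 * Real.pi) → HasSum (fun i : ℕ => a.1 i s * v s ^ (i + 2)) (deriv v s) ∧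
      HasDerivAt v (deriv v s) s := by
  filter_upwards [(ae_restrict_iff' measurableSet_Icc).1 h.2.2] with s hs hm
  obtain ⟨v', h1, h2⟩ := hs (Ioo_subset_Icc_self hm)
  rw [h2.deriv]
  exact ⟨h1, h2⟩

/-- Solutions with small initial values stay small. -/
lemma IsSolution.norm_le (h : IsSolution a r v) (hl : 0 < l)
    (ha : ∀ i x, ‖a.1 i x‖ ≤ l ^ (i + 1)) (hδ : 0 < δ) (hlδ : 2 * l * δ ≤ 1 / 26)
    (hr : ‖r‖ ≤ δ / 2) {x : ℝ} (hx : x ∈ Icc 0 (2 * Real.pi)) : ‖v x‖ ≤ δ := by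
  by_contra! hlt
  obtain ⟨⟨K, hK⟩, h0, -⟩ := id h
  -- If the bound fails, this set is nonempty, and its least element `y` is the first time at which
  -- `‖v‖` reaches `δ`; the estimate on the vector field is available before `y`.
  have hc : IsCompact {y ∈ Icc 0 (2 * Real.pi) | δ ≤ ‖v y‖} := by
    refine isCompact_Icc.of_isClosed_subset ?_ (sep_subset _ _)
    exact isClosed_Icc.isClosed_le continuousOn_const hK.continuousOn.norm
  obtain ⟨y, ⟨hy, hvy⟩, hmin⟩ := hc.exists_isLeast ⟨x, hx, hlt.le⟩
  have hsub : Icc 0 y ⊆ Icc 0 (2 * Real.pi) := Icc_subset_Icc_right hy.2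
  have hsmall : ∀ s ∈ Ioo 0 y, ‖v s‖ ≤ δ := by
    intro s hs
    by_contra! hs'
    exact absurd (hmin ⟨⟨hs.1.le, hs.2.le.trans hy.2⟩, hs'.le⟩) (not_le.2 hs.2)
  have hae : ∀ᵐ s, s ∈ Ioo 0 y → HasDerivAt v (deriv v s) s := by
    filter_upwards [h.ae_hasDerivAt] with s hs hm using (hs ⟨hm.1, hm.2.trans_le hy.2⟩).2
  obtain ⟨-, e⟩ := sub_eq_integral_of_lipschitzOnWith hy.1 (hK.mono hsub) hae
  have hb : ‖∫ s in (0 : ℝ)..y, deriv v s‖ ≤ δ / 26 * |y - 0| := by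
    refine intervalIntegral.norm_integral_le_of_norm_le_const_ae ?_
    filter_upwards [h.ae_hasDerivAt, Measure.ae_ne volume y] with s hs hne hm
    rw [uIoc_of_le hy.1] at hm
    have hm' : s ∈ Ioo 0 y := ⟨hm.1, lt_of_le_of_ne hm.2 hne⟩
    have hsum := (hs ⟨hm'.1, hm'.2.trans_le hy.2⟩).1
    have := hsum.norm_le_of_bounded (hasSum_half_pow.mul_left (δ ^ 1 * (2 * l * δ))) fun j => by
      have := norm_coeff_mul_pow_le hl ha hδ.le (hlδ.trans (by norm_num)) 1 j s (hsmall s hm')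
      rwa [show 1 + j + 1 = j + 2 by ring] at this
    rw [pow_one, mul_one] at this
    refine this.trans ?_
    rw [div_eq_mul_one_div]
    gcongr
  rw [← e, h0, sub_zero, abs_of_nonneg hy.1] at hb
  have h1 : ‖v y‖ ≤ ‖r‖ + ‖v y - r‖ := by
    simpa using norm_add_le r (v y - r)
  -- The displacement up to `y` is at most `6.4 δ / 26 < δ / 2`, too small to go from `‖r‖ ≤ δ / 2`
  -- to `‖v y‖ ≥ δ`.
  have h2 : y ≤ 6.4 := hy.2.trans (by linarith [Real.pi_lt_d2])
  nlinarith

lemma IsSolution.ae_hasDerivAt_pow (h : IsSolution a r v) (m : ℕ) :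
    ∀ᵐ s, s ∈ Ioo 0 (2 * Real.pi) →
      HasSum (fun j : ℕ => m * (a.1 j s * v s ^ (m + j + 1))) (m * v s ^ (m - 1) * deriv v s) ∧
      HasDerivAt (fun x => v x ^ m) (m * v s ^ (m - 1) * deriv v s) s := by
  filter_upwards [h.ae_hasDerivAt] with s hs hm
  obtain ⟨h1, h2⟩ := hs hm
  refine ⟨?_, h2.fun_pow m⟩
  have e : (fun j : ℕ => m * (a.1 j s * v s ^ (m + j + 1))) =
      fun j => m * v s ^ (m - 1) * (a.1 j s * v s ^ (j + 2)) := by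
    funext j
    -- For `m = 0` the truncated exponent `m - 1` is harmless, since the factor `m` vanishes.
    rcases m with _ | m
    · simp
    · rw [Nat.add_sub_cancel]; ring
  rw [e]
  exact h1.mul_left _

lemma lipschitzOnWith_pow {K : NNReal} {s : Set ℝ} (hK : LipschitzOnWith K v s)
    (hδ : 0 ≤ δ) (hv : ∀ x ∈ s, ‖v x‖ ≤ δ) (m : ℕ) :
    LipschitzOnWith (m * δ.toNNReal ^ (m - 1) * K) (fun x => v x ^ m) s := by
  refine LipschitzOnWith.of_dist_le_mul fun y hy z hz => ?_
  rw [dist_eq_norm]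
  refine (norm_pow_sub_pow_le (hv y hy) (hv z hz) m).trans ?_
  have := hK.dist_le_mul y hy z hz
  rw [dist_eq_norm] at this
  push_cast
  rw [Real.coe_toNNReal δ hδ, mul_assoc _ (K : ℝ)]
  gcongr

/-- The expansion of the powers of a solution in powers of the initial value. -/
lemma IsSolution.norm_pow_sub_sum_le (h : IsSolution a r v) (hl : 0 < l)
    (ha : ∀ i x, ‖a.1 i x‖ ≤ l ^ (i + 1)) (hδ : 0 < δ) (hlδ : 2 * l * δ ≤ 1)
    (hv : ∀ x ∈ Icc 0 (2 * Real.pi), ‖v x‖ ≤ δ) (N : ℕ) (d m : ℕ) (hd : d = N - m)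
    {x : ℝ} (hx : x ∈ Icc 0 (2 * Real.pi)) :
    ‖v x ^ m - ∑ k ∈ Finset.range d, (flowCoeff k m fun w => iterInt a.1 w x) * r ^ (m + k)‖ ≤
      ((2 * l) ^ m)⁻¹ * (2 * l * δ) ^ N * Real.exp (N * x) := by
  induction d using Nat.strong_induction_on generalizing m x with
  | _ d ih =>
    rcases d with _ | d
    · have hm : N ≤ m := by omega
      rw [Finset.sum_range_zero, sub_zero, norm_pow]
      calc ‖v x‖ ^ m ≤ δ ^ m * 1 := by rw [mul_one]; have := hv x hx; gcongr
        _ = ((2 * l) ^ m)⁻¹ * (2 * l * δ) ^ m * 1 := by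
            rw [mul_pow (2 * l) δ, inv_mul_cancel_left₀ (by positivity)]
        _ ≤ _ := by
            gcongr ?_ * ?_ * ?_
            · exact pow_le_pow_of_le_one (by positivity) hlδ hm
            · exact Real.one_le_exp (by have := hx.1; positivity)
    · set P : ℕ → ℝ → ℂ := fun j s => a.1 j s * ∑ k ∈ Finset.range (d - j),
        (flowCoeff k (m + j + 1) fun w => iterInt a.1 w s) * r ^ (m + j + 1 + k) with hP
      have hPi : ∀ j, IntervalIntegrable (P j) volume 0 x := fun j =>
        intervalIntegrable_mul a j (continuous_finsetSum _ fun k _ =>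
          (continuous_flowCoeff k (m + j + 1) (continuous_iterInt a)).mul continuous_const) 0 x
      have hsum : ∑ k ∈ Finset.range (d + 1),
          (flowCoeff k m fun w => iterInt a.1 w x) * r ^ (m + k) =
          r ^ m + ∫ s in (0 : ℝ)..x, m * ∑ j ∈ Finset.range d, P j s := by
        rw [Finset.sum_range_succ', flowCoeff_zero, iterInt, one_mul, add_zero, add_comm,
          intervalIntegral.integral_const_mul, intervalIntegral.integral_finsetSum fun j _ => hPi j]
        congr 1
        have e1 : ∀ j ∈ Finset.range d, ∫ s in (0 : ℝ)..x, P j s =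
            ∑ k ∈ Finset.range (d - j), (∫ s in (0 : ℝ)..x,
              a.1 j s * flowCoeff k (m + j + 1) fun w => iterInt a.1 w s) *
                r ^ (m + j + 1 + k) := by
          intro j _
          simp only [hP, Finset.mul_sum, ← mul_assoc]
          rw [intervalIntegral.integral_finsetSum fun k _ => (intervalIntegrable_mul a j
            (continuous_flowCoeff k (m + j + 1) (continuous_iterInt a)) 0 x).mul_const _]
          simp only [intervalIntegral.integral_mul_const]
        -- Summation over the triangle `j ≤ k < d` is reordered so that the inner sum is the
        -- recursion for `flowCoeff (k + 1) m`.
        rw [Finset.sum_congr rfl e1, ← Finset.sum_range_diag_flip, Finset.mul_sum]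
        refine Finset.sum_congr rfl fun k _ => ?_
        rw [flowCoeff_succ_iterInt, mul_assoc, Finset.sum_mul]
        congr 1
        refine Finset.sum_congr rfl fun j hj => ?_
        have := Finset.mem_range.1 hj
        rw [show m + j + 1 + (k - j) = m + (k + 1) by omega]
      have hsub : Icc 0 x ⊆ Icc 0 (2 * Real.pi) := Icc_subset_Icc_right hx.2
      obtain ⟨⟨K, hK⟩, h0, -⟩ := id h
      obtain ⟨hi, e⟩ := sub_eq_integral_of_lipschitzOnWith (b := x) hx.1
        ((lipschitzOnWith_pow hK hδ.le hv m).mono hsub) (by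
          filter_upwards [h.ae_hasDerivAt_pow m] with s hs hm
          exact (hs ⟨hm.1, hm.2.trans_le hx.2⟩).2)
      have hN : 0 < N := by omega
      have hmN : (m : ℝ) ≤ N := by exact_mod_cast (by omega : m ≤ N)
      have hmain : v x ^ m - ∑ k ∈ Finset.range (d + 1),
          (flowCoeff k m fun w => iterInt a.1 w x) * r ^ (m + k) =
          ∫ s in (0 : ℝ)..x, (m * v s ^ (m - 1) * deriv v s - m * ∑ j ∈ Finset.range d, P j s) := by
        rw [intervalIntegral.integral_sub hi, hsum, ← e, h0]
        · ring
        · refine IntervalIntegrable.const_mul ?_ _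
          have := IntervalIntegrable.sum (Finset.range d) fun j _ => hPi j
          rwa [Finset.sum_fn] at this
      have hbd := norm_integral_mul_exp_le hN hx.1
        (f := fun s => m * v s ^ (m - 1) * deriv v s - m * ∑ j ∈ Finset.range d, P j s)
        (C := m * (((2 * l) ^ m)⁻¹ * (2 * l * δ) ^ N)) (by positivity) (by
          filter_upwards [h.ae_hasDerivAt_pow m, Measure.ae_ne volume (2 * Real.pi)] with s hs hne hm
          have hs' : s ∈ Icc 0 (2 * Real.pi) := hsub ⟨hm.1.le, hm.2⟩
          have h1 := (hs ⟨hm.1, lt_of_le_of_ne hs'.2 hne⟩).1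
          -- For `j ≥ d` the truncated `d - j` is zero and so is `P j`. The finite sum can thus be
          -- compared termwise with the whole series for `(v^m)'`, the tail being covered by the
          -- base case of the induction.
          have h2 : HasSum (fun j => m * P j s) (m * ∑ j ∈ Finset.range d, P j s) := by
            refine (hasSum_sum_of_ne_finset_zero fun j hj => ?_).mul_left _
            have : d ≤ j := by simpa using hj
            simp [hP, Nat.sub_eq_zero_of_le this]
          have := (h1.sub h2).norm_le_of_bounded (hasSum_half_pow.mul_left
            (m * (((2 * l) ^ m)⁻¹ * (2 * l * δ) ^ N) * Real.exp (N * s))) fun j => by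
              rw [hP, ← mul_sub, ← mul_sub, norm_mul, norm_mul, Complex.norm_natCast]
              calc _ ≤ m * (l ^ (j + 1) * (((2 * l) ^ (m + j + 1))⁻¹ * (2 * l * δ) ^ N *
                    Real.exp (N * s))) := by
                    gcongr
                    · exact ha j s
                    · exact ih (d - j) (by omega) (m + j + 1) (by omega) hs'
                _ = _ := by
                    -- The quotient `l^(j+1) / (2l)^(m+j+1)` equals `(2l)^(-m) (1/2)^(j+1)`, and the
                    -- last factor sums to `1` over `j`.
                    rw [add_assoc m, pow_add (2 * l) m, mul_inv, one_div, inv_pow,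
                      mul_pow 2 l (j + 1), mul_inv]
                    field_simp
          simpa using this)
      rw [hmain]
      refine le_of_mul_le_mul_left (hbd.trans ?_) (by exact_mod_cast hN : (0 : ℝ) < N)
      rw [mul_assoc]
      gcongr

end Solutions

/-! ### Existence of solutions with small initial value -/

/-- The right-hand side `∑_{i ≥ 1} a_i(s) z^{i+1}` of the equation. -/
def vectorField (a : X) (s : ℝ) (z : ℂ) : ℂ := ∑' j, a.1 j s * z ^ (j + 2)

section Existence

variable {a : X} {l δ : ℝ}

lemma hasSum_vectorField (hl : 0 < l) (ha : ∀ i x, ‖a.1 i x‖ ≤ l ^ (i + 1))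
    (hδ : 0 < δ) (hlδ : 2 * l * δ ≤ 1 / 26) (s : ℝ) {z : ℂ} (hz : ‖z‖ ≤ δ) :
    HasSum (fun j => a.1 j s * z ^ (j + 2)) (vectorField a s z) := by
  refine (Summable.of_norm_bounded (hasSum_half_pow.mul_left (δ ^ 1 * (2 * l * δ))).summable
    fun j => ?_).hasSum
  have := norm_coeff_mul_pow_le hl ha hδ.le (hlδ.trans (by norm_num)) 1 j s hz
  rwa [show 1 + j + 1 = j + 2 by ring] at this

lemma norm_vectorField_sub_le (hl : 0 < l) (ha : ∀ i x, ‖a.1 i x‖ ≤ l ^ (i + 1))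
    (hδ : 0 < δ) (hlδ : 2 * l * δ ≤ 1 / 26) (s : ℝ) {z w : ℂ} (hz : ‖z‖ ≤ δ) (hw : ‖w‖ ≤ δ) :
    ‖vectorField a s z - vectorField a s w‖ ≤ 1 / 13 * ‖z - w‖ := by
  have h := ((hasSum_vectorField hl ha hδ hlδ s hz).sub
    (hasSum_vectorField hl ha hδ hlδ s hw)).norm_le_of_bounded
    (hasSum_half_pow.mul_left (1 / 13 * ‖z - w‖)) fun j => by
      rw [← mul_sub, norm_mul]
      -- The exponent `j + 2` produced by the difference of powers is absorbed into `2^(j+1)`,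
      -- leaving `(2 l δ)^(j+1)`.
      have hj : ((j + 2 : ℕ) : ℝ) ≤ 2 ^ (j + 1) := by exact_mod_cast Nat.lt_two_pow_self (n := j + 1)
      calc _ ≤ l ^ (j + 1) * (2 ^ (j + 1) * δ ^ (j + 1) * ‖z - w‖) := by
            gcongr
            · exact ha j s
            · refine (norm_pow_sub_pow_le hz hw (j + 2)).trans ?_
              rw [show j + 2 - 1 = j + 1 by omega]
              gcongr
        _ = (2 * l * δ) ^ (j + 1) * ‖z - w‖ := by ring
        _ ≤ (1 / 13 * (1 / 2)) ^ (j + 1) * ‖z - w‖ := by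
            gcongr ?_ ^ _ * _; exact hlδ.trans (by norm_num)
        _ = (1 / 13) ^ (j + 1) * (1 / 2) ^ (j + 1) * ‖z - w‖ := by rw [mul_pow]
        _ ≤ (1 / 13) * (1 / 2) ^ (j + 1) * ‖z - w‖ := by
            gcongr
            exact pow_le_of_le_one (by norm_num) (by norm_num) (by omega)
        _ = _ := by ring
  simpa using h

lemma norm_vectorField_le (hl : 0 < l) (ha : ∀ i x, ‖a.1 i x‖ ≤ l ^ (i + 1))
    (hδ : 0 < δ) (hlδ : 2 * l * δ ≤ 1 / 26) (s : ℝ) {z : ℂ} (hz : ‖z‖ ≤ δ) :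
    ‖vectorField a s z‖ ≤ 1 / 13 * δ := by
  have h := norm_vectorField_sub_le hl ha hδ hlδ s hz (w := 0) (by simpa using hδ.le)
  simp only [vectorField, sub_zero] at h
  simp only [ne_eq, Nat.add_eq_zero_iff, OfNat.ofNat_ne_zero, and_false, not_false_eq_true,
    zero_pow, mul_zero, tsum_zero, sub_zero] at h
  exact h.trans (by gcongr)

lemma intervalIntegrable_vectorField (hl : 0 < l) (ha : ∀ i x, ‖a.1 i x‖ ≤ l ^ (i + 1))
    (hδ : 0 < δ) (hlδ : 2 * l * δ ≤ 1 / 26) {u : ℝ → ℂ} (hu : Continuous u)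
    (hb : ∀ s, ‖u s‖ ≤ δ) (x y : ℝ) :
    IntervalIntegrable (fun s => vectorField a s (u s)) volume x y := by
  have hm : Measurable fun s => vectorField a s (u s) := by
    refine measurable_of_tendsto_metrizable
      (f := fun n s => ∑ j ∈ Finset.range n, a.1 j s * u s ^ (j + 2)) (fun n => ?_) ?_
    · exact Finset.measurable_sum _ fun j _ =>
        (a.2.1 j).mul (hu.measurable.pow_const _)
    · exact tendsto_pi_nhds.2 fun s => (hasSum_vectorField hl ha hδ hlδ s (hb s)).tendsto_sum_nat
  exact (intervalIntegrable_const (c := 1 / 13 * δ)).mono_fun hm.aestronglyMeasurable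
    (.of_forall fun s => by
      rw [Real.norm_of_nonneg (by positivity)]
      exact norm_vectorField_le hl ha hδ hlδ s (hb s))

/-- Banach's fixed point theorem for the Picard operator on the closed ball of radius `δ` in `C([0,
2π])`. Functions are extended constantly beyond the interval, so that the bound `δ` holds on all of
`ℝ`. -/
lemma exists_integral_solution (hl : 0 < l) (ha : ∀ i x, ‖a.1 i x‖ ≤ l ^ (i + 1))
    (hδ : 0 < δ) (hlδ : 2 * l * δ ≤ 1 / 26) {r : ℂ} (hr : ‖r‖ ≤ δ / 2) :
    ∃ u : ℝ → ℂ, Continuous u ∧ (∀ s, ‖u s‖ ≤ δ) ∧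
      ∀ x ∈ Icc 0 (2 * Real.pi), u x = r + ∫ s in (0 : ℝ)..x, vectorField a s (u s) := by
  have hπ : (0 : ℝ) ≤ 2 * Real.pi := Real.two_pi_pos.le
  have hπ' : 2 * Real.pi ≤ 6.4 := by linarith [Real.pi_lt_d2]
  set Y := Metric.closedBall (0 : C(Icc (0 : ℝ) (2 * Real.pi), ℂ)) δ with hY
  have : CompleteSpace Y := Metric.isClosed_closedBall.completeSpace_coe
  have hYb : ∀ u : Y, ∀ s, ‖IccExtend hπ u.1 s‖ ≤ δ := fun u s =>
    (u.1.norm_coe_le_norm _).trans (mem_closedBall_zero_iff.1 u.2)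
  have hYi : ∀ u : Y, ∀ x y, IntervalIntegrable
      (fun s => vectorField a s (IccExtend hπ u.1 s)) volume x y := fun u =>
    intervalIntegrable_vectorField hl ha hδ hlδ u.1.continuous.Icc_extend' (hYb u)
  -- Since `2π / 13 < 1/2`, this one estimate gives both invariance of the ball (with `‖r‖ ≤ δ / 2`)
  -- and contraction by `1/2`.
  have hbd : ∀ (g : ℝ → ℂ) (C : ℝ), (∀ s, ‖g s‖ ≤ 1 / 13 * C) → 0 ≤ C →
      ∀ x : Icc (0 : ℝ) (2 * Real.pi), ‖∫ s in (0 : ℝ)..x, g s‖ ≤ 1 / 2 * C := by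
    intro g C hg hC x
    refine (intervalIntegral.norm_integral_le_of_norm_le_const fun s _ => hg s).trans ?_
    rw [sub_zero, abs_of_nonneg x.2.1]
    have := x.2.2
    nlinarith
  let Φ : Y → Y := fun u => ⟨⟨fun x => r + ∫ s in (0 : ℝ)..x,
      vectorField a s (IccExtend hπ u.1 s), continuous_const.add
        ((intervalIntegral.continuous_primitive (hYi u) 0).comp continuous_subtype_val)⟩, by
    refine mem_closedBall_zero_iff.2 ((ContinuousMap.norm_le _ hδ.le).2 ?_)
    intro x
    refine (norm_add_le _ _).trans ?_
    have := hbd _ δ (fun s => norm_vectorField_le hl ha hδ hlδ s (hYb u s)) hδ.le x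
    linarith⟩
  have hΦ : ContractingWith (1 / 2) Φ := by
    refine ⟨by norm_num, LipschitzWith.of_dist_le_mul fun u w => ?_⟩
    rw [Subtype.dist_eq, Subtype.dist_eq, ContinuousMap.dist_le (by positivity)]
    intro x
    rw [dist_eq_norm]
    show ‖(r + ∫ s in (0 : ℝ)..x, vectorField a s (IccExtend hπ u.1 s)) -
      (r + ∫ s in (0 : ℝ)..x, vectorField a s (IccExtend hπ w.1 s))‖ ≤ _
    rw [add_sub_add_left_eq_sub, ← intervalIntegral.integral_sub (hYi u _ _) (hYi w _ _)]
    push_cast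
    refine hbd _ _ (fun s => ?_) dist_nonneg x
    refine (norm_vectorField_sub_le hl ha hδ hlδ s (hYb u s) (hYb w s)).trans ?_
    gcongr
    rw [← dist_eq_norm]
    exact ContinuousMap.dist_apply_le_dist _
  have : Nonempty Y := ⟨⟨0, Metric.mem_closedBall_self hδ.le⟩⟩
  set u := ContractingWith.fixedPoint Φ hΦ with hu
  have hfix : Φ u = u := ContractingWith.fixedPoint_isFixedPt hΦ
  refine ⟨IccExtend hπ u.1, u.1.continuous.Icc_extend', hYb u, fun x hx => ?_⟩
  have := congrArg (fun w : Y => w.1 ⟨x, hx⟩) hfix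
  rw [IccExtend_of_mem hπ _ hx]
  exact this.symm

lemma exists_isSolution (hl : 0 < l) (ha : ∀ i x, ‖a.1 i x‖ ≤ l ^ (i + 1))
    (hδ : 0 < δ) (hlδ : 2 * l * δ ≤ 1 / 26) {r : ℂ} (hr : ‖r‖ ≤ δ / 2) :
    ∃ v, IsSolution a r v := by
  obtain ⟨u, huc, hub, hu⟩ := exists_integral_solution hl ha hδ hlδ hr
  have hi := intervalIntegrable_vectorField hl ha hδ hlδ huc hub
  refine ⟨fun x => r + ∫ s in (0 : ℝ)..x, vectorField a s (u s), ⟨(1 / 13 * δ).toNNReal, ?_⟩,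
    by simp, ?_⟩
  · have := lipschitzOnWith_integral (K := (1 / 13 * δ).toNNReal) (hi 0 (2 * Real.pi))
      (.of_forall fun s _ => by
        rw [Real.coe_toNNReal _ (by positivity)]
        exact norm_vectorField_le hl ha hδ hlδ s (hub s))
    refine LipschitzOnWith.of_dist_le_mul fun y hy z hz => ?_
    rw [dist_add_left]
    exact this.dist_le_mul y hy z hz
  · rw [ae_restrict_iff' measurableSet_Icc]
    filter_upwards [(hi 0 (2 * Real.pi)).ae_hasDerivAt_integral] with s hs hm
    have hm' : s ∈ uIcc 0 (2 * Real.pi) := by rwa [uIcc_of_le Real.two_pi_pos.le]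
    refine ⟨vectorField a s (u s), ?_, (hs hm' 0 left_mem_uIcc).const_add r⟩
    have := hasSum_vectorField hl ha hδ hlδ s (hub s)
    rwa [hu s hm] at this ⊢

end Existence

/-! ### The first return map as a power series -/

lemma exists_radius (a : X) : ∃ l δ : ℝ, 0 < l ∧ (∀ i x, ‖a.1 i x‖ ≤ l ^ (i + 1)) ∧ 0 < δ ∧
    2 * l * δ ≤ 1 / 26 ∧ 2 * l * δ * Real.exp (2 * Real.pi) < 1 := by
  obtain ⟨-, -, l, hl, ha⟩ := a.2
  have he : 1 ≤ Real.exp (2 * Real.pi) := Real.one_le_exp Real.two_pi_pos.le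
  -- With this `δ` one has `2 l δ exp(2π) = 1/26`, which serves both inequalities.
  refine ⟨l, 1 / (52 * l * Real.exp (2 * Real.pi)), hl, ha, by positivity, ?_, ?_⟩
  · rw [mul_one_div, div_le_iff₀ (by positivity)]
    nlinarith
  · have : 2 * l * (1 / (52 * l * Real.exp (2 * Real.pi))) * Real.exp (2 * Real.pi) = 1 / 26 := by
      field_simp; norm_num
    rw [this]; norm_num

/-- The first return map of `a`, written in terms of the basic iterated integrals of `a`. -/
def returnMap (a : X) : Gc where
  series := PowerSeries.mk fun n => if n = 0 then 0 else flowCoeff (n - 1) 1 fun w => basicInt w a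
  coeff_zero := by simp
  coeff_one := by simp [flowCoeff_zero, basicInt_nil]
  converges := by
    obtain ⟨l, δ, hl, ha, hδ, -, h⟩ := exists_radius a
    refine ⟨δ, hδ, fun z hz => ?_⟩
    rw [← summable_nat_add_iff 1]
    set q := 2 * l * Real.exp (2 * Real.pi) * ‖z‖ with hq
    have hq1 : q < 1 := by
      refine lt_of_le_of_lt ?_ h
      rw [hq, mul_right_comm]; gcongr
    refine Summable.of_norm_bounded (g := fun n => (Real.exp (2 * Real.pi) * ‖z‖) * q ^ n)
      ((summable_geometric_of_lt_one (by positivity) hq1).mul_left _) fun n => ?_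
    rw [PowerSeries.coeff_mk, if_neg (by omega), Nat.add_sub_cancel, norm_mul, norm_pow]
    have hb := norm_flowCoeff_le hl ha n 1 Real.two_pi_pos.le
    calc _ ≤ (2 * l) ^ n * Real.exp ((1 + n : ℕ) * (2 * Real.pi)) * ‖z‖ ^ (n + 1) := by
          gcongr; exact hb
      _ = _ := by rw [Real.exp_nat_mul, hq]; ring

lemma coeff_succ_returnMap (a : X) (n : ℕ) :
    PowerSeries.coeff (n + 1) (returnMap a).series = flowCoeff n 1 fun w => basicInt w a := by
  simp [returnMap]

theorem isFirstReturnMap_returnMap (a : X) : IsFirstReturnMap a (returnMap a) := by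
  obtain ⟨l, δ, hl, ha, hδ, hlδ, hq⟩ := exists_radius a
  obtain ⟨ρ, hρ, hconv⟩ := (returnMap a).converges
  refine ⟨min ρ (δ / 2), by positivity, fun r hr => ?_⟩
  have hr1 : ‖r‖ < ρ := hr.trans_le (min_le_left _ _)
  have hr2 : ‖r‖ ≤ δ / 2 := hr.le.trans (min_le_right _ _)
  refine ⟨exists_isSolution hl ha hδ hlδ hr2, fun v hv => ?_⟩
  have hs := hconv r hr1
  rw [hs.hasSum_iff_tendsto_nat]
  -- The remainder estimate for `m = 1` at `x = 2π`; the choice of `δ` makes the right side a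
  -- geometric sequence tending to zero.
  have hexp : ∀ N, ‖v (2 * Real.pi) - ∑ n ∈ Finset.range (N + 1),
      PowerSeries.coeff n (returnMap a).series * r ^ n‖ ≤
      (2 * l)⁻¹ * (2 * l * δ * Real.exp (2 * Real.pi)) ^ (N + 1) := by
    intro N
    have := hv.norm_pow_sub_sum_le hl ha hδ (hlδ.trans (by norm_num))
      (fun x hx => hv.norm_le hl ha hδ hlδ hr2 hx) (N + 1) N 1 (by omega)
      (right_mem_Icc.2 Real.two_pi_pos.le)
    rw [pow_one, pow_one, Real.exp_nat_mul, mul_assoc, ← mul_pow] at this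
    rw [Finset.sum_range_succ', (returnMap a).coeff_zero, zero_mul, add_zero]
    simpa only [coeff_succ_returnMap, add_comm 1, basicInt] using this
  rw [← Filter.tendsto_add_atTop_iff_nat 1, tendsto_iff_norm_sub_tendsto_zero]
  refine squeeze_zero (fun _ => norm_nonneg _) (fun N => (norm_sub_rev _ _).trans_le (hexp N)) ?_
  have := ((tendsto_pow_atTop_nhds_zero_of_lt_one (by positivity) hq).comp
    (Filter.tendsto_add_atTop_nat 1)).const_mul (2 * l)⁻¹
  simpa using this

lemma Gc.ext_coeff {f g : Gc}
    (h : ∀ n, PowerSeries.coeff n f.series = PowerSeries.coeff n g.series) : f = g := by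
  obtain ⟨f, _, _, _⟩ := f
  obtain ⟨g, _, _, _⟩ := g
  have : f = g := PowerSeries.ext h
  subst this
  rfl

/-- The function defined by an element of `G_c[[r]]` near the origin. -/
def Gc.eval (f : Gc) (z : ℂ) : ℂ := ∑' n, PowerSeries.coeff n f.series * z ^ n

lemma Gc.exists_pow_bound (f : Gc) : ∃ M : ℝ, 0 < M ∧
    ∀ n, ‖PowerSeries.coeff n f.series‖ ≤ M ^ n := by
  obtain ⟨M, hM, h⟩ := f.exists_bound
  refine ⟨max 1 M, by positivity, fun n => ?_⟩
  rcases n with _ | _ | n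
  · simp [f.coeff_zero]
  · simp [f.coeff_one]
  · calc _ ≤ M ^ (n + 1) := h (n + 1) (by omega)
      _ ≤ max 1 M ^ (n + 1) := by gcongr; exact le_max_right _ _
      _ ≤ _ := pow_le_pow_right₀ (le_max_left _ _) (by omega)

lemma Gc.exists_hasFPowerSeriesAt (f : Gc) : ∃ ρ : ℝ, 0 < ρ ∧
    (∀ z : ℂ, ‖z‖ < ρ → HasSum (fun n => PowerSeries.coeff n f.series * z ^ n) (f.eval z)) ∧
    HasFPowerSeriesAt f.eval
      (FormalMultilinearSeries.ofScalars ℂ fun n => PowerSeries.coeff n f.series) 0 := by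
  obtain ⟨ρ, hρ, h⟩ := f.converges
  refine ⟨ρ, hρ, fun z hz => (h z hz).hasSum, ?_⟩
  rw [hasFPowerSeriesAt_iff]
  filter_upwards [Metric.ball_mem_nhds (0 : ℂ) hρ] with z hz
  rw [mem_ball_zero_iff] at hz
  simpa [mul_comm, Gc.eval] using (h z hz).hasSum

/-- Uniqueness of power series expansions. It reduces every later identity between first return maps
to an identity of values near `0`. -/
lemma Gc.ext_eval {f g : Gc} (h : ∀ᶠ z in nhds (0 : ℂ), f.eval z = g.eval z) : f = g := by
  obtain ⟨-, -, -, hf⟩ := f.exists_hasFPowerSeriesAt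
  obtain ⟨-, -, -, hg⟩ := g.exists_hasFPowerSeriesAt
  have := hf.eq_formalMultilinearSeries_of_eventually hg h
  refine Gc.ext_coeff fun n => ?_
  have := congrArg (fun p : FormalMultilinearSeries ℂ ℂ ℂ => p.coeff n) this
  simpa using this

lemma Gc.eval_zero (f : Gc) : f.eval 0 = 0 := by
  rw [Gc.eval, tsum_eq_single 0]
  · simp [f.coeff_zero]
  · intro n hn; simp [hn]

lemma Gc.tendsto_eval (f : Gc) : Filter.Tendsto f.eval (nhds 0) (nhds 0) := by
  obtain ⟨-, -, -, hf⟩ := f.exists_hasFPowerSeriesAt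
  have := hf.analyticAt.continuousAt.tendsto
  rwa [f.eval_zero] at this

lemma Gc.eval_one (z : ℂ) : (1 : Gc).eval z = z := by
  rw [Gc.eval, tsum_eq_single 1]
  · rw [(1 : Gc).coeff_one]; ring
  · intro n hn
    show PowerSeries.coeff n (PowerSeries.X : PowerSeries ℂ) * z ^ n = 0
    rw [PowerSeries.coeff_X, if_neg hn, zero_mul]

lemma IsFirstReturnMap.eventually {a : X} {f : Gc} (h : IsFirstReturnMap a f) :
    ∀ᶠ r in nhds (0 : ℂ), (∃ v, IsSolution a r v) ∧
      ∀ v, IsSolution a r v → v (2 * Real.pi) = f.eval r := by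
  obtain ⟨ρ, hρ, h⟩ := h
  filter_upwards [Metric.ball_mem_nhds (0 : ℂ) hρ] with r hr
  rw [mem_ball_zero_iff] at hr
  exact ⟨(h r hr).1, fun v hv => ((h r hr).2 v hv).tsum_eq.symm⟩

lemma IsFirstReturnMap.unique {a : X} {f g : Gc} (hf : IsFirstReturnMap a f)
    (hg : IsFirstReturnMap a g) : f = g := by
  refine Gc.ext_eval ?_
  filter_upwards [hf.eventually, hg.eventually] with r h1 h2
  obtain ⟨v, hv⟩ := h1.1
  rw [← h1.2 v hv, h2.2 v hv]

lemma returnMap_congr {a b : X} (h : G.mk a = G.mk b) : returnMap a = returnMap b := by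
  refine Gc.ext_coeff fun n => ?_
  simp only [returnMap]
  rw [funext (G.mk_eq_iff.1 h)]

/-- `returnMap` witnesses the property defining the choice in `Phat`, because it is constant on
classes; uniqueness of the first return map identifies the two. -/
theorem Phat_mk (a : X) : Phat (G.mk a) = returnMap a := by
  have hex : ∃ f : Gc, ∀ b : X, G.mk b = G.mk a → IsFirstReturnMap b f :=
    ⟨returnMap a, fun b hb => returnMap_congr hb ▸ isFirstReturnMap_returnMap b⟩
  have := @Classical.epsilon_spec _ (fun f : Gc => ∀ b : X, G.mk b = G.mk a → IsFirstReturnMap b f) hex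
  exact (this a rfl).unique (isFirstReturnMap_returnMap a)

theorem isFirstReturnMap_Phat (a : X) : IsFirstReturnMap a (Phat (G.mk a)) := by
  rw [Phat_mk]; exact isFirstReturnMap_returnMap a

/-! ### Composition of first return maps -/

/-- Pulls "almost every" statements about a solution back along the rescaling of half of the
interval. -/
lemma quasiMeasurePreserving_half_add (c : ℝ) :
    Measure.QuasiMeasurePreserving (fun x : ℝ => x * (1 / 2) + c) volume volume := by
  have h1 : Measure.QuasiMeasurePreserving (fun x : ℝ => x * (1 / 2)) volume volume := by
    refine ⟨by fun_prop, Measure.AbsolutelyContinuous.mk fun s hs h0 => ?_⟩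
    rw [Measure.map_apply (by fun_prop) hs, Real.volume_preimage_mul_right (by norm_num), h0,
      mul_zero]
  exact (measurePreserving_add_right volume c).quasiMeasurePreserving.comp h1

/-- The restriction of a solution to a half of `[0, 2π]`, rescaled to `[0, 2π]`. -/
lemma IsSolution.half {e a : X} {r : ℂ} {u : ℝ → ℂ} (h : IsSolution e r u) {c : ℝ}
    (h0 : 0 ≤ c) (h1 : c ≤ Real.pi)
    (hc : ∀ x ∈ Ioc 0 (2 * Real.pi), ∀ i, e.1 i (x * (1 / 2) + c) = 2 * a.1 i x) :
    IsSolution a (u c) fun x => u (x * (1 / 2) + c) := by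
  have hmaps : ∀ x ∈ Icc 0 (2 * Real.pi), x * (1 / 2) + c ∈ Icc 0 (2 * Real.pi) := by
    intro x hx
    have h2 := hx.1
    have h3 := hx.2
    constructor <;> linarith
  obtain ⟨⟨K, hK⟩, -, hd⟩ := h
  refine ⟨⟨K, LipschitzOnWith.of_dist_le_mul fun y hy z hz => ?_⟩, by simp, ?_⟩
  · refine (hK.dist_le_mul _ (hmaps y hy) _ (hmaps z hz)).trans ?_
    gcongr
    rw [dist_add_right, Real.dist_eq, Real.dist_eq, ← sub_mul, abs_mul]
    norm_num
    linarith [abs_nonneg (y - z)]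
  · rw [ae_restrict_iff' measurableSet_Icc] at hd ⊢
    -- The point `0` is discarded because the relation between the coefficients is only assumed on
    -- `(0, 2π]`.
    filter_upwards [(quasiMeasurePreserving_half_add c).ae hd, Measure.ae_ne volume 0] with
      x hx hne hm
    obtain ⟨v', hs, hv⟩ := hx (hmaps x hm)
    refine ⟨(1 / 2 : ℝ) • v', ?_, ?_⟩
    · rw [Complex.real_smul]
      have e : (fun i : ℕ => a.1 i x * u (x * (1 / 2) + c) ^ (i + 2)) = fun i =>
          ((1 / 2 : ℝ) : ℂ) * (e.1 i (x * (1 / 2) + c) * u (x * (1 / 2) + c) ^ (i + 2)) := by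
        funext i
        rw [hc x ⟨lt_of_le_of_ne hm.1 (Ne.symm hne), hm.2⟩]
        push_cast
        ring
      rw [e]
      exact hs.mul_left _
    · exact HasDerivAt.scomp (h := fun x : ℝ => x * (1 / 2) + c) x hv
        (((hasDerivAt_id x).mul_const (1 / 2 : ℝ)).add_const c |>.congr_deriv (by ring))

lemma IsSolution.left {a b : X} {r : ℂ} {u : ℝ → ℂ} (h : IsSolution (a * b) r u) :
    IsSolution a r fun x => u (x * (1 / 2) + 0) := by
  have := h.half (a := a) le_rfl Real.pi_pos.le fun x hx i => by
    have h1 := hx.1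
    have h2 := hx.2
    rw [mul_apply, concat_left _ _ (by linarith) (by linarith)]
    congr 2; ring
  rwa [h.2.1] at this

lemma IsSolution.right {a b : X} {r : ℂ} {u : ℝ → ℂ} (h : IsSolution (a * b) r u) :
    IsSolution b (u Real.pi) fun x => u (x * (1 / 2) + Real.pi) :=
  h.half Real.pi_pos.le le_rfl fun x hx i => by
    have h1 := hx.1
    have h2 := hx.2
    rw [mul_apply, concat_right _ _ (by linarith) (by linarith)]
    congr 2; ring

theorem eval_Phat_mul (g h : G) :
    ∀ᶠ r in nhds (0 : ℂ), (Phat (g * h)).eval r = (Phat h).eval ((Phat g).eval r) := by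
  obtain ⟨a, rfl⟩ : ∃ a, G.mk a = g := Quotient.exists_rep g
  obtain ⟨b, rfl⟩ : ∃ b, G.mk b = h := Quotient.exists_rep h
  filter_upwards [(isFirstReturnMap_Phat (a * b)).eventually, (isFirstReturnMap_Phat a).eventually,
    (Phat (G.mk a)).tendsto_eval.eventually (isFirstReturnMap_Phat b).eventually] with r h1 h2 h3
  obtain ⟨u, hu⟩ := h1.1
  -- The first half ends at `u π`, which is therefore `P̂([a])(r)`, and this is the initial value of
  -- the second half.
  have e2 := h2.2 _ hu.left
  rw [show 2 * Real.pi * (1 / 2) + 0 = Real.pi by ring] at e2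
  have e3 := h3.2 _ (e2 ▸ hu.right)
  rw [show 2 * Real.pi * (1 / 2) + Real.pi = 2 * Real.pi by ring] at e3
  exact (h1.2 u hu).symm.trans e3

lemma isSolution_zero (r : ℂ) : IsSolution 0 r fun _ => r :=
  ⟨⟨0, LipschitzWith.const r |>.lipschitzOnWith⟩, rfl, .of_forall fun x =>
    ⟨0, by simp [show ∀ i, (0 : X).1 i x = 0 from fun _ => rfl],
      hasDerivAt_const x r⟩⟩

lemma Phat_one : Phat 1 = 1 := by
  refine Gc.ext_eval ?_
  filter_upwards [(isFirstReturnMap_Phat 0).eventually] with r hr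
  rw [Gc.eval_one]
  exact (hr.2 _ (isSolution_zero r)).symm

lemma Phat_mul_of_eq_one {g c : G} (hc : Phat c = 1) : Phat (g * c) = Phat g := by
  refine Gc.ext_eval ?_
  filter_upwards [eval_Phat_mul g c] with r hr
  rw [hr, hc, Gc.eval_one]

lemma Phat_inv_mul_of_eq {g h : G} (hgh : Phat g = Phat h) : Phat (g⁻¹ * h) = 1 := by
  rw [← Phat_one, ← inv_mul_cancel g]
  refine Gc.ext_eval ?_
  filter_upwards [eval_Phat_mul g⁻¹ h, eval_Phat_mul g⁻¹ g] with r h1 h2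
  rw [h1, h2, hgh]

/-! ### Topology of `G(X)` and of `G_c[[r]]` -/

lemma G.continuous_basicInt (w : List ℕ) : Continuous (G.basicInt w) :=
  continuous_iInf_dom (i := w) continuous_induced_dom

lemma G.continuous_iff {S : Type*} [TopologicalSpace S] {φ : S → G} :
    Continuous φ ↔ ∀ w, Continuous fun s => G.basicInt w (φ s) := by
  simp only [continuous_iInf_rng, continuous_induced_rng, Function.comp_def]

lemma Gc.continuous_d (k : ℕ) : Continuous (Gc.d k) := by
  rcases k with _ | k
  · have : Gc.d 0 = fun _ => 1 := funext fun f => f.coeff_one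
    rw [this]; exact continuous_const
  · exact continuous_iInf_dom (i := k) continuous_induced_dom

lemma Gc.continuous_iff {S : Type*} [TopologicalSpace S] {φ : S → Gc} :
    Continuous φ ↔ ∀ k, Continuous fun s => (φ s).d (k + 1) := by
  simp only [continuous_iInf_rng, continuous_induced_rng, Function.comp_def]

lemma G.basicInt_mul (w : List ℕ) (g h : G) :
    G.basicInt w (g * h) = conv (fun u => G.basicInt u h) (fun v => G.basicInt v g) w := by
  obtain ⟨a, rfl⟩ : ∃ a, G.mk a = g := Quotient.exists_rep g
  obtain ⟨b, rfl⟩ : ∃ b, G.mk b = h := Quotient.exists_rep h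
  exact CenterProblem.basicInt_mul a b w

lemma G.basicInt_nil (g : G) : G.basicInt [] g = 1 := by
  obtain ⟨a, rfl⟩ : ∃ a, G.mk a = g := Quotient.exists_rep g
  rfl

lemma continuous_conv_of_length_le {S : Type*} [TopologicalSpace S] {F H : List ℕ → S → ℂ}
    (hF : ∀ u, Continuous (F u)) (w : List ℕ)
    (hH : ∀ u : List ℕ, u.length ≤ w.length → Continuous (H u)) :
    Continuous fun s => conv (fun u => F u s) (fun v => H v s) w := by
  induction w generalizing F with
  | nil => simp only [conv]; exact (hF []).mul (hH [] le_rfl)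
  | cons j w ih =>
    simp only [conv]
    exact ((hF []).mul (hH _ le_rfl)).add
      (ih (fun u => hF (j :: u)) fun u hu => hH u (by simp; omega))

instance : ContinuousMul G where
  continuous_mul := by
    refine G.continuous_iff.2 fun w => ?_
    simp only [G.basicInt_mul]
    exact continuous_conv_of_length_le (fun u => (G.continuous_basicInt u).comp continuous_snd) w
      fun u _ => (G.continuous_basicInt u).comp continuous_fst

instance : ContinuousInv G where
  continuous_inv := by
    refine G.continuous_iff.2 fun w => ?_
    obtain ⟨n, hn⟩ : ∃ n, w.length = n := ⟨_, rfl⟩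
    induction n using Nat.strong_induction_on generalizing w with
    | _ n ih =>
      rcases w with _ | ⟨j, w⟩
      · simp only [G.basicInt_nil]; exact continuous_const
      -- Expanding `g⁻¹ g = 1` on the word `j :: w` isolates the integral at `g⁻¹`; the other terms
      -- involve `g⁻¹` only on words no longer than `w`, so induction on length applies.
      · have e : ∀ g : G, G.basicInt (j :: w) g⁻¹ = G.basicInt (j :: w) 1 -
            conv (fun u => G.basicInt (j :: u) g) (fun v => G.basicInt v g⁻¹) w := by
          intro g
          rw [← inv_mul_cancel g, G.basicInt_mul, conv, G.basicInt_nil]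
          ring
        simp only [e]
        refine continuous_const.sub (continuous_conv_of_length_le
          (fun u => G.continuous_basicInt (j :: u)) w fun u hu => ih u.length ?_ u rfl)
        rw [← hn]; simp; omega

lemma continuous_Phat : Continuous Phat := by
  refine Gc.continuous_iff.2 fun k => ?_
  have e : ∀ g : G, (Phat g).d (k + 1) = flowCoeff (k + 1) 1 fun w => G.basicInt w g := by
    intro g
    obtain ⟨a, rfl⟩ : ∃ a, G.mk a = g := Quotient.exists_rep g
    rw [Phat_mk, Gc.d, coeff_succ_returnMap]
    rfl
  simp only [e]
  exact continuous_flowCoeff _ _ G.continuous_basicInt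

lemma continuous_coeff_denSeries_joint (n : ℕ) :
    Continuous fun p : Gc × ℝ => PowerSeries.coeff n (denSeries p.1 p.2) := by
  have := (Gc.continuous_d n).comp (continuous_fst (X := Gc) (Y := ℝ))
  simp only [Function.comp_def] at this
  simp only [denSeries, PowerSeries.coeff_mk]
  split_ifs <;> fun_prop

lemma continuous_coeff_denSeries_inv_joint (n : ℕ) :
    Continuous fun p : Gc × ℝ => PowerSeries.coeff n (denSeries p.1 p.2)⁻¹ := by
  induction n using Nat.strong_induction_on with
  | _ n ih =>
    simp only [coeff_denSeries_inv _ _ n]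
    split_ifs with hn
    · exact continuous_const
    · refine (continuous_finsetSum _ fun p _ => ?_).neg
      split_ifs with hp
      · exact (continuous_coeff_denSeries_joint p.1).mul (ih p.2 hp)
      · exact continuous_const

lemma continuous_coeff_numSeries_mul_inv (n : ℕ) :
    Continuous fun p : Gc × ℝ =>
      PowerSeries.coeff n (numSeries p.1 * (denSeries p.1 p.2)⁻¹) := by
  simp only [PowerSeries.coeff_mul]
  refine continuous_finsetSum _ fun q _ => Continuous.mul ?_
    (continuous_coeff_denSeries_inv_joint q.2)
  have := (Gc.continuous_d (q.1 - 1)).comp (continuous_fst (X := Gc) (Y := ℝ))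
  simp only [Function.comp_def] at this
  simp only [numSeries, PowerSeries.coeff_mk]
  split_ifs <;> fun_prop

lemma coeffOf_apply (f : Gc) (i : ℕ) {t : ℝ} (ht : t ∈ Ioc 0 (2 * Real.pi)) :
    (coeffOf f).1 i t = PowerSeries.coeff (i + 2) (numSeries f * (denSeries f t)⁻¹) := by
  show PowerSeries.coeff (i + 2) (numSeries f * (denSeries f (angle t))⁻¹) = _
  rw [angle_of_mem ht]

/-- The periodic extension of `a(f)` may jump at multiples of `2π`. On `[0, 2π]` it is replaced by
the formula without reduction of the angle, jointly continuous in `(f, x)`; the endpoint does not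
affect the integrals. -/
lemma exists_continuous_iterInt_coeffOf (w : List ℕ) :
    ∃ J : Gc × ℝ → ℂ, Continuous J ∧
      ∀ f, ∀ x ∈ Icc 0 (2 * Real.pi), iterInt (coeffOf f).1 w x = J (f, x) := by
  induction w with
  | nil => exact ⟨fun _ => 1, continuous_const, fun _ _ _ => rfl⟩
  | cons j w ih =>
    obtain ⟨J, hJ, h⟩ := ih
    refine ⟨fun p => ∫ s in (0 : ℝ)..p.2,
      PowerSeries.coeff (j + 2) (numSeries p.1 * (denSeries p.1 s)⁻¹) * J (p.1, s), ?_, ?_⟩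
    · refine intervalIntegral.continuous_parametric_intervalIntegral_of_continuous
        (f := fun (p : Gc × ℝ) (s : ℝ) =>
          PowerSeries.coeff (j + 2) (numSeries p.1 * (denSeries p.1 s)⁻¹) * J (p.1, s)) ?_
        continuous_snd
      have hq : Continuous fun q : (Gc × ℝ) × ℝ => (q.1.1, q.2) := by fun_prop
      exact ((continuous_coeff_numSeries_mul_inv (j + 2)).comp hq).mul (hJ.comp hq)
    · intro f x hx
      rw [iterInt]
      refine intervalIntegral.integral_congr_Ioo_of_le hx.1 fun s hs => ?_
      rw [coeffOf_apply f j ⟨hs.1, hs.2.le.trans hx.2⟩, h f s ⟨hs.1.le, hs.2.le.trans hx.2⟩]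

lemma continuous_T : Continuous T := by
  refine G.continuous_iff.2 fun w => ?_
  obtain ⟨J, hJ, h⟩ := exists_continuous_iterInt_coeffOf w
  have e : (fun f => G.basicInt w (T f)) = fun f => J (f, 2 * Real.pi) :=
    funext fun f => h f _ (right_mem_Icc.2 Real.two_pi_pos.le)
  rw [e]
  exact hJ.comp (by fun_prop)

/-! ### The map `T` is a section of the first return map -/

section ReturnMapOfT

variable {f : Gc} {M : ℝ} {z : ℂ}

lemma Gc.hasSum_eval (hM : 0 < M) (h : ∀ n, ‖PowerSeries.coeff n f.series‖ ≤ M ^ n)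
    (hz : ‖z‖ < 1 / (4 * M)) :
    HasSum (fun n => PowerSeries.coeff n f.series * z ^ n) (f.eval z) := by
  refine (Summable.of_norm_bounded (g := fun n => (1 / 4 : ℝ) ^ n)
    (summable_geometric_of_lt_one (by norm_num) (by norm_num)) fun n => ?_).hasSum
  rw [norm_mul, norm_pow]
  calc _ ≤ M ^ n * (1 / (4 * M)) ^ n := by gcongr; exact h n
    _ = _ := by rw [← mul_pow]; congr 1; field_simp

lemma Gc.hasDerivAt_eval (hM : 0 < M) (h : ∀ n, ‖PowerSeries.coeff n f.series‖ ≤ M ^ n)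
    (hz : ‖z‖ < 1 / (4 * M)) :
    ∃ D, HasSum (fun n : ℕ => ((n : ℂ) + 1) * PowerSeries.coeff (n + 1) f.series * z ^ n) D ∧
      HasDerivAt f.eval D z := by
  have hb : ∀ (n : ℕ) (y : ℂ), y ∈ Metric.ball (0 : ℂ) (1 / (4 * M)) →
      ‖PowerSeries.coeff n f.series * (n * y ^ (n - 1))‖ ≤ 4 * M * (1 / 2) ^ n := by
    intro n y hy
    rw [mem_ball_zero_iff] at hy
    rcases n with _ | n
    · simp only [Nat.cast_zero, zero_mul, mul_zero, norm_zero]; positivity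
    -- The factor from differentiation is at most `2^(n+1)`; the radius `1 / (4M)` still leaves the
    -- ratio `1/2`.
    · have hn : ((n + 1 : ℕ) : ℝ) ≤ 2 ^ (n + 1) := by exact_mod_cast Nat.lt_two_pow_self.le
      rw [norm_mul, norm_mul, norm_pow, Complex.norm_natCast, Nat.add_sub_cancel]
      calc _ ≤ M ^ (n + 1) * (2 ^ (n + 1) * (1 / (4 * M)) ^ n) := by
            gcongr; exact h (n + 1)
        _ = 2 * M * (M * 2 * (1 / (4 * M))) ^ n := by rw [mul_pow, mul_pow]; ring
        _ = 4 * M * (1 / 2) ^ (n + 1) := by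
            rw [show M * 2 * (1 / (4 * M)) = 1 / 2 by field_simp; norm_num]; ring
  have hu : Summable fun n : ℕ => 4 * M * (1 / 2 : ℝ) ^ n :=
    (summable_geometric_of_lt_one (by norm_num) (by norm_num)).mul_left _
  have hz' : z ∈ Metric.ball (0 : ℂ) (1 / (4 * M)) := by rwa [mem_ball_zero_iff]
  have hd := hasDerivAt_tsum_of_isPreconnected hu Metric.isOpen_ball
    (convex_ball (0 : ℂ) (1 / (4 * M))).isPreconnected
    (fun n y _ => (hasDerivAt_pow n y).const_mul (PowerSeries.coeff n f.series)) hb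
    (Metric.mem_ball_self (by positivity))
    (Gc.hasSum_eval hM h (z := 0) (by simpa using hM)).summable hz'
  refine ⟨_, ?_, hd⟩
  have hs := (Summable.of_norm_bounded hu fun n => hb n z hz').hasSum
  rw [← hasSum_nat_add_iff' 1] at hs
  simp only [Finset.range_one, Finset.sum_singleton, Nat.cast_zero, zero_mul, mul_zero, sub_zero,
    Nat.add_sub_cancel] at hs
  refine hs.congr_fun fun n => ?_
  push_cast; ring

/-- Here `D` plays the role of `f'(z)`: the denominator is the derivative in `z` of `(1 - x/2π) f(z)
+ (x/2π) z`. -/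
lemma hasSum_denSeries {D : ℂ} (x : ℝ)
    (hD : HasSum (fun n : ℕ => ((n : ℂ) + 1) * PowerSeries.coeff (n + 1) f.series * z ^ n) D) :
    HasSum (fun n => PowerSeries.coeff n (denSeries f x) * z ^ n)
      ((1 - (x : ℂ) / (2 * Real.pi)) * D + (x : ℂ) / (2 * Real.pi)) := by
  have h := (hD.mul_left (1 - (x : ℂ) / (2 * Real.pi))).add
    (hasSum_ite_eq (0 : ℕ) ((x : ℂ) / (2 * Real.pi)))
  refine h.congr_fun fun n => ?_
  rcases n with _ | n
  · simp [denSeries, f.coeff_one]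
  · simp [denSeries, Gc.d]; ring

lemma hasSum_numSeries {y : ℂ}
    (h : HasSum (fun n => PowerSeries.coeff n f.series * z ^ n) y) :
    HasSum (fun n => PowerSeries.coeff n (numSeries f) * z ^ n) ((y - z) / (2 * Real.pi)) := by
  have h := (h.sub (hasSum_ite_eq (1 : ℕ) z)).div_const (2 * Real.pi : ℂ)
  refine h.congr_fun fun n => ?_
  rcases n with _ | _ | n
  · simp [numSeries, f.coeff_zero]
  · simp [numSeries, f.coeff_one]
  · simp [numSeries, Gc.d]; ring

/-- The formal quotient is multiplied back by its denominator and the Cauchy product is summed, so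
neither nonvanishing of the denominator's sum nor convergence of its inverse is needed. -/
lemma denSeries_mul_eq {D y w : ℂ} (x : ℝ)
    (hD : HasSum (fun n : ℕ => ((n : ℂ) + 1) * PowerSeries.coeff (n + 1) f.series * z ^ n) D)
    (hy : HasSum (fun n => PowerSeries.coeff n f.series * z ^ n) y)
    (hw : HasSum (fun i => PowerSeries.coeff (i + 2) (numSeries f * (denSeries f x)⁻¹) *
      z ^ (i + 2)) w) :
    ((1 - (x : ℂ) / (2 * Real.pi)) * D + (x : ℂ) / (2 * Real.pi)) * w =
      (y - z) / (2 * Real.pi) := by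
  set Q := numSeries f * (denSeries f x)⁻¹ with hQ
  have hnum0 : PowerSeries.coeff 0 (numSeries f) = 0 := by simp [numSeries]
  have hnum1 : PowerSeries.coeff 1 (numSeries f) = 0 := by simp [numSeries]
  have hQ0 : PowerSeries.coeff 0 Q = 0 := by
    rw [hQ, PowerSeries.coeff_mul, Finset.Nat.antidiagonal_zero, Finset.sum_singleton, hnum0,
      zero_mul]
  have hQ1 : PowerSeries.coeff 1 Q = 0 := by
    rw [hQ, PowerSeries.coeff_mul, Finset.Nat.sum_antidiagonal_succ, Finset.Nat.antidiagonal_zero,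
      Finset.sum_singleton, hnum0]
    simp [hnum1]
  have hw' : HasSum (fun n => PowerSeries.coeff n Q * z ^ n) w := by
    have := (hasSum_nat_add_iff (f := fun n => PowerSeries.coeff n Q * z ^ n) 2).1 hw
    simpa [Finset.sum_range_succ, hQ0, hQ1] using this
  have hd := hasSum_denSeries x hD
  have hmul : denSeries f x * Q = numSeries f := by
    rw [hQ, mul_left_comm, PowerSeries.mul_inv_cancel _ (by rw [constantCoeff_denSeries]; simp),
      mul_one]
  rw [← hd.tsum_eq, ← hw'.tsum_eq, ← (hasSum_numSeries hy).tsum_eq,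
    tsum_mul_tsum_eq_tsum_sum_antidiagonal_of_summable_norm hd.summable.norm hw'.summable.norm]
  congr 1
  funext n
  rw [← hmul, PowerSeries.coeff_mul, Finset.sum_mul]
  refine Finset.sum_congr rfl fun p hp => ?_
  rw [← Finset.HasAntidiagonal.mem_antidiagonal.1 hp, pow_add]
  ring

end ReturnMapOfT

/-- Along a solution of the equation for `a(f)` the function
`(1 - x/2π) f(v) + (x/2π) v` is constant. -/
theorem Phat_T (f : Gc) : Phat (T f) = f := by
  obtain ⟨-, -, l, hl, ha⟩ := (coeffOf f).2
  obtain ⟨M, hM, hf⟩ := f.exists_pow_bound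
  obtain ⟨-, -, -, hps⟩ := f.exists_hasFPowerSeriesAt
  obtain ⟨L, t, ht, hL⟩ :=
    ((hps.analyticAt.contDiffAt (n := 1)).exists_lipschitzOnWith : ∃ K, ∃ t ∈ nhds (0 : ℂ),
      LipschitzOnWith K f.eval t)
  obtain ⟨ε, hε, hεt⟩ := Metric.mem_nhds_iff.1 ht
  -- The three bounds keep solutions within `δ`, allow termwise differentiation of `f`, and stay in
  -- a ball where `f` is Lipschitz, so that `f ∘ v` is absolutely continuous.
  obtain ⟨δ, hδ, hδ1, hδ2, hδ3⟩ : ∃ δ : ℝ, 0 < δ ∧ 2 * l * δ ≤ 1 / 26 ∧ δ < 1 / (4 * M) ∧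
      δ < ε := by
    have h := (Filter.tendsto_id (α := ℝ) (x := nhdsWithin 0 (Ioi 0))).mono_right nhdsWithin_le_nhds
    have h1 := (h.const_mul (2 * l)).eventually_lt_const
      (show 2 * l * 0 < (1 / 26 : ℝ) by norm_num)
    obtain ⟨δ, h2, h3, h4, h5⟩ := (h1.and ((h.eventually_lt_const
      (show (0 : ℝ) < 1 / (4 * M) by positivity)).and
        ((h.eventually_lt_const hε).and self_mem_nhdsWithin))).exists
    exact ⟨δ, h5, h2.le, h3, h4⟩
  refine Gc.ext_eval ?_
  filter_upwards [(isFirstReturnMap_Phat (coeffOf f)).eventually,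
    Metric.closedBall_mem_nhds (0 : ℂ) (half_pos hδ)] with r hr hrδ
  rw [mem_closedBall_zero_iff] at hrδ
  obtain ⟨v, hv⟩ := hr.1
  refine (hr.2 v hv).symm.trans ?_
  have hvδ : ∀ x ∈ Icc 0 (2 * Real.pi), ‖v x‖ ≤ δ := fun x hx =>
    hv.norm_le hl ha hδ hδ1 hrδ hx
  obtain ⟨⟨K, hK⟩, h0, -⟩ := id hv
  have hπ := Real.two_pi_pos
  have hAv : AbsolutelyContinuousOnInterval v 0 (2 * Real.pi) :=
    LipschitzOnWith.absolutelyContinuousOnInterval (by rwa [uIcc_of_le hπ.le])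
  have hAf : AbsolutelyContinuousOnInterval (f.eval ∘ v) 0 (2 * Real.pi) := by
    refine LipschitzOnWith.absolutelyContinuousOnInterval (K := L * K) ?_
    rw [uIcc_of_le hπ.le]
    refine hL.comp hK fun x hx => hεt ?_
    rw [mem_ball_zero_iff]
    exact (hvδ x hx).trans_lt hδ3
  have hA1 : AbsolutelyContinuousOnInterval (fun x : ℝ => 1 - x / (2 * Real.pi)) 0 (2 * Real.pi) :=
    ContDiffOn.absolutelyContinuousOnInterval (by fun_prop)
  have hA2 : AbsolutelyContinuousOnInterval (fun x : ℝ => x / (2 * Real.pi)) 0 (2 * Real.pi) :=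
    ContDiffOn.absolutelyContinuousOnInterval (by fun_prop)
  obtain ⟨C, hC⟩ := ((hA1.smul hAf).add (hA2.smul hAv)).const_of_ae_hasDerivAt_zero (by
    filter_upwards [hv.ae_hasDerivAt, Measure.ae_ne volume 0, Measure.ae_ne volume (2 * Real.pi)]
      with s hs h1 h2 hm
    rw [uIcc_of_le hπ.le] at hm
    have hs' : s ∈ Ioo 0 (2 * Real.pi) :=
      ⟨lt_of_le_of_ne hm.1 (Ne.symm h1), lt_of_le_of_ne hm.2 h2⟩
    obtain ⟨h3, h4⟩ := hs hs'
    have hz := (hvδ s hm).trans_lt hδ2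
    obtain ⟨D, hD, hD'⟩ := Gc.hasDerivAt_eval hM hf hz
    have hid := denSeries_mul_eq (w := deriv v s) s hD (Gc.hasSum_eval hM hf hz) (by
      simpa only [coeffOf_apply f _ (Ioo_subset_Ioc_self hs')] using h3)
    have hlin : HasDerivAt (fun x : ℝ => x / (2 * Real.pi)) (1 / (2 * Real.pi)) s :=
      (hasDerivAt_id s).div_const _
    have hfv : HasDerivAt (f.eval ∘ v) (D * deriv v s) s := hD'.comp s h4
    -- The derivative is `((1 - s/2π) f'(v) + s/2π) v' - (f(v) - v)/2π`, which vanishes by `hid`.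
    refine (((hlin.const_sub 1).smul hfv).add (hlin.smul h4)).congr_deriv ?_
    simp only [Complex.real_smul, Function.comp_apply]
    push_cast
    linear_combination hid)
  have e := (hC _ right_mem_uIcc).trans (hC _ left_mem_uIcc).symm
  have hne : 2 * Real.pi / (2 * Real.pi) = 1 := div_self hπ.ne'
  simpa [h0, hne] using e

/-! ### Splitting of the group over its section -/

lemma leftInverse_Phat_T : Function.LeftInverse Phat T := Phat_T

lemma isHomeomorph_T_mul : IsHomeomorph fun p : Gc × Chat => T p.1 * (p.2 : G) := by
  rw [isHomeomorph_iff_exists_inverse]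
  -- Right multiplication by the kernel does not change the first return map, so the first component
  -- is recovered by `Phat` and the second by left division by `T`.
  have hP : ∀ p : Gc × Chat, Phat (T p.1 * (p.2 : G)) = p.1 := fun p => by
    rw [Phat_mul_of_eq_one p.2.2, Phat_T]
  refine ⟨(continuous_T.comp continuous_fst).mul (continuous_subtype_val.comp continuous_snd),
    fun g => (Phat g, ⟨(T (Phat g))⁻¹ * g, Phat_inv_mul_of_eq (Phat_T _)⟩), fun p => ?_,
    fun g => mul_inv_cancel_left _ _, ?_⟩
  · refine Prod.ext (hP p) (Subtype.ext ?_)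
    show (T (Phat (T p.1 * (p.2 : G))))⁻¹ * (T p.1 * p.2) = p.2
    rw [hP, inv_mul_cancel_left]
  · exact continuous_Phat.prodMk
      (((continuous_T.comp continuous_Phat).inv.mul continuous_id).subtype_mk _)

end CenterProblem

end

theorem theorem3p10 :
    (∀ a : CenterProblem.X,
      CenterProblem.IsFirstReturnMap a (CenterProblem.Phat (CenterProblem.G.mk a))) ∧
    Topology.IsEmbedding CenterProblem.T ∧
    (∀ f : CenterProblem.Gc, CenterProblem.Phat (CenterProblem.T f) = f) ∧
    IsHomeomorph (fun p : CenterProblem.Gc × CenterProblem.Chat =>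
      CenterProblem.T p.1 * (p.2 : CenterProblem.G)) :=
  ⟨CenterProblem.isFirstReturnMap_Phat,
    CenterProblem.leftInverse_Phat_T.isEmbedding CenterProblem.continuous_Phat
      CenterProblem.continuous_T,
    CenterProblem.Phat_T, CenterProblem.isHomeomorph_T_mul⟩
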